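/- Let $M$ be a compact metric space with at least two points and with a distinguished point $0\in M$. Let $\mathrm{Lip}_0(M)$ be the real Banach space of Lipschitz functions $f\colon M\to\mathbb R$ with $f(0)=0$, normed by the Lipschitz constant $\|f\|_L=\sup_{x\ne y}\frac{|f(x)-f(y)|}{d(x,y)}$, and let the Lipschitz-free space $\mathcal F(M)=\overline{\operatorname{span}}\{\delta_x:x\in M\}\subset \mathrm{Lip}_0(M)^*$ be the norm-closed linear span of the evaluation functionals $\delta_x(f)=f(x)$. The following assertions are equivalent: 1. $M$ is geodesic, that is, for all $x,y\in M$ the distance $d(x,y)$ is the infimum of the lengths of the rectifiable curves joining $x$ and $y$, and this infimum is attained. 2. For all $x\neq y$ in $M$, the metric segment $[x,y]=\{z\in M: d(x,z)+d(z,y)=d(x,y)\}$ contains a point other than $x$ and $y$. 3. $\mathrm{Lip}_0(M)$ has the Daugavet property, that is, $\|T+I\|=1+\|T\|$ for every bounded linear operator $T$ of rank one on $\mathrm{Lip}_0(M)$, where $I$ is the identity operator. 4. The closed unit ball of $\mathcal F(M)$ has no preserved extreme point, that is, no $\mu\in\mathcal F(M)$ whose canonical image in the bidual $\mathcal F(M)^{**}$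 is an extreme point of the closed unit ball of $\mathcal F(M)^{**}$. 5. The closed unit ball $B$ of $\mathcal F(M)$ has no strongly exposed point, that is, there is no $\mu\in\mathcal F(M)$ with $\|\mu\|=1$ for which some $\varphi\in\mathcal F(M)^*$ with $\|\varphi\|=1$ has the property that every sequence $(\mu_n)$ in $B$ with $\varphi(\mu_n)\to\varphi(\mu)$ converges to $\mu$ in norm. 6. The norm of $\mathrm{Lip}_0(M)$ is not Gâteaux differentiable at any point of $\mathrm{Lip}_0(M)$. 7. The norm of $\mathrm{Lip}_0(M)$ is not Fréchet differentiable at any point of $\mathrm{Lip}_0(M)$. -/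

import Mathlib

open scoped ENNReal NNReal Topology
open Filter

/-! ### Metric notions -/

section MetricNotions

variable {M : Type*} [MetricSpace M]

/-- The length of a continuous curve: the supremum of the lengths of inscribed polygonal chains. -/
noncomputable def curveLength {x y : M} (γ : Path x y) : ℝ≥0∞ :=
  eVariationOn (γ : unitInterval → M) Set.univ

/-- `M` is geodesic: for all `x y`, the distance from `x` to `y` is the infimum, and the infimum is
attained, of the lengths of the rectifiable curves joining `x` to `y`. -/
def IsGeodesicSpace (M : Type*) [MetricSpace M] : Prop :=
  ∀ x y : M, IsLeast {ℓ : ℝ≥0∞ | ∃ γ : Path x y, curveLength γ = ℓ ∧ ℓ ≠ ∞} (edist x y)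

/-- The metric segment `[x, y]`. -/
def metricSegment (x y : M) : Set M :=
  {z | dist x z + dist z y = dist x y}

end MetricNotions

/-! ### Notions for normed spaces -/

section NormedNotions

/-- The Daugavet property: every bounded linear operator `T` of rank one satisfies
`‖T + I‖ = 1 + ‖T‖`. -/
def HasDaugavetProperty (X : Type*) [NormedAddCommGroup X] [NormedSpace ℝ X] : Prop :=
  ∀ T : X →L[ℝ] X, Module.finrank ℝ (LinearMap.range (T : X →ₗ[ℝ] X)) = 1 →
    ‖T + ContinuousLinearMap.id ℝ X‖ = 1 + ‖T‖

variable {X : Type*} [NormedAddCommGroup X] [NormedSpace ℝ X]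

/-- `x` is a preserved extreme point of the closed unit ball of `X`: its canonical image in the
bidual is an extreme point of the closed unit ball of the bidual. -/
def IsPreservedExtremePoint (x : X) : Prop :=
  NormedSpace.inclusionInDoubleDual ℝ X x ∈
    Set.extremePoints ℝ (Metric.closedBall (0 : StrongDual ℝ (StrongDual ℝ X)) 1)

/-- `x` is a strongly exposed point of the closed unit ball of `X`: it has norm one and, for some
functional `f` of norm one, every sequence `(xₙ)` in the ball with `f xₙ → f x` converges to `x` in
norm. -/
def IsStronglyExposedPoint (x : X) : Prop :=
  ‖x‖ = 1 ∧ ∃ f : StrongDual ℝ X, ‖f‖ = 1 ∧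
    ∀ u : ℕ → X, (∀ n, u n ∈ Metric.closedBall (0 : X) 1) →
      Tendsto (fun n => f (u n)) atTop (𝓝 (f x)) → Tendsto u atTop (𝓝 x)

/-- `g` is Gâteaux differentiable at `x`: the directional derivatives at `x` exist in all directions
and are given by a bounded linear functional of the direction. -/
def GateauxDifferentiableAt (g : X → ℝ) (x : X) : Prop :=
  ∃ φ : StrongDual ℝ X, ∀ h : X, HasLineDerivAt ℝ g (φ h) x h

end NormedNotions

/-! ### Lipschitz functions vanishing at the base point -/

section LipZero

variable {M : Type*} [MetricSpace M]

/-- The vector space of real Lipschitz functions on `M` that vanish at the base point `o`. -/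
def lipZeroSubmodule (o : M) : Submodule ℝ (M → ℝ) where
  carrier := {f | (∃ K : ℝ≥0, LipschitzWith K f) ∧ f o = 0}
  add_mem' := by
    rintro f g ⟨⟨K, hf⟩, hf0⟩ ⟨⟨L, hg⟩, hg0⟩
    exact ⟨⟨K + L, hf.add hg⟩, by simp [hf0, hg0]⟩
  zero_mem' := ⟨⟨0, LipschitzWith.const 0⟩, rfl⟩
  smul_mem' := by
    rintro c f ⟨⟨K, hf⟩, hf0⟩
    refine ⟨⟨‖c‖₊ * K, LipschitzWith.of_dist_le_mul fun x y => ?_⟩, by simp [hf0]⟩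
    have h := hf.dist_le_mul x y
    simp only [Pi.smul_apply, dist_smul₀, NNReal.coe_mul, coe_nnnorm, mul_assoc]
    gcongr

/-- `Lip₀(M)` for the metric space `M` pointed at `o`. It is a type of its own, so that its norm and
topology are the ones defined below and not those of the product space `M → ℝ`. -/
def LipZero (o : M) : Type _ := lipZeroSubmodule o

namespace LipZero

variable {o : M}

noncomputable instance : AddCommGroup (LipZero o) :=
  inferInstanceAs (AddCommGroup (lipZeroSubmodule o))

noncomputable instance : Module ℝ (LipZero o) :=
  inferInstanceAs (Module ℝ (lipZeroSubmodule o))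

instance : CoeFun (LipZero o) fun _ => M → ℝ := ⟨fun f => f.1⟩

theorem ext' {f g : LipZero o} (h : ∀ x, f x = g x) : f = g := Subtype.ext (funext h)

theorem map_base (f : LipZero o) : f o = 0 := f.2.2

theorem add_apply (f g : LipZero o) (x : M) : (f + g) x = f x + g x := rfl

theorem smul_apply (c : ℝ) (f : LipZero o) (x : M) : (c • f) x = c * f x := rfl

theorem zero_apply (x : M) : (0 : LipZero o) x = 0 := rfl

/-- The norm of `f` is its Lipschitz constant, the supremum of `|f x - f y| / d(x, y)` over all
pairs of distinct points. -/
noncomputable instance : Norm (LipZero o) :=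
  ⟨fun f => ⨆ p : {p : M × M // p.1 ≠ p.2}, |f p.1.1 - f p.1.2| / dist p.1.1 p.1.2⟩

theorem norm_def (f : LipZero o) :
    ‖f‖ = ⨆ p : {p : M × M // p.1 ≠ p.2}, |f p.1.1 - f p.1.2| / dist p.1.1 p.1.2 := rfl

theorem bddAbove_slopes (f : LipZero o) :
    BddAbove (Set.range fun p : {p : M × M // p.1 ≠ p.2} =>
      |f p.1.1 - f p.1.2| / dist p.1.1 p.1.2) := by
  obtain ⟨K, hK⟩ := f.2.1
  refine ⟨K, ?_⟩
  rintro _ ⟨⟨⟨x, y⟩, hxy⟩, rfl⟩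
  have h := hK.dist_le_mul x y
  rw [Real.dist_eq] at h
  exact (div_le_iff₀ (dist_pos.2 hxy)).2 h

theorem norm_nonneg' (f : LipZero o) : 0 ≤ ‖f‖ :=
  Real.iSup_nonneg fun _ => by positivity

theorem abs_sub_le (f : LipZero o) (x y : M) : |f x - f y| ≤ ‖f‖ * dist x y := by
  rcases eq_or_ne x y with rfl | hxy
  · simp
  · exact (div_le_iff₀ (dist_pos.2 hxy)).1 (le_ciSup (bddAbove_slopes f) ⟨(x, y), hxy⟩)

theorem norm_le_of_forall {f : LipZero o} {C : ℝ} (hC : 0 ≤ C)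
    (h : ∀ x y, |f x - f y| ≤ C * dist x y) : ‖f‖ ≤ C :=
  Real.iSup_le (fun p => (div_le_iff₀ (dist_pos.2 p.2)).2 (h _ _)) hC

theorem norm_smul_le' (c : ℝ) (f : LipZero o) : ‖c • f‖ ≤ ‖c‖ * ‖f‖ := by
  refine norm_le_of_forall (mul_nonneg (norm_nonneg c) (norm_nonneg' f)) fun x y => ?_
  rw [smul_apply, smul_apply, ← mul_sub, abs_mul, mul_assoc, Real.norm_eq_abs]
  exact mul_le_mul_of_nonneg_left (abs_sub_le f x y) (abs_nonneg c)

theorem normedSpaceCore : NormedSpace.Core ℝ (LipZero o) where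
  norm_nonneg := norm_nonneg'
  norm_smul c f := by
    refine le_antisymm (norm_smul_le' c f) ?_
    rcases eq_or_ne c 0 with rfl | hc
    · simpa using norm_nonneg' ((0 : ℝ) • f)
    · have h := norm_smul_le' c⁻¹ (c • f)
      rw [smul_smul, inv_mul_cancel₀ hc, one_smul, norm_inv] at h
      have hc' : 0 < ‖c‖ := norm_pos_iff.2 hc
      calc ‖c‖ * ‖f‖ ≤ ‖c‖ * (‖c‖⁻¹ * ‖c • f‖) := by gcongr
        _ = ‖c • f‖ := by field_simp
  norm_triangle f g := by
    refine norm_le_of_forall (add_nonneg (norm_nonneg' f) (norm_nonneg' g)) fun x y => ?_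
    calc |(f + g) x - (f + g) y| = |(f x - f y) + (g x - g y)| := by
          rw [add_apply, add_apply]; ring_nf
      _ ≤ |f x - f y| + |g x - g y| := abs_add_le _ _
      _ ≤ (‖f‖ + ‖g‖) * dist x y := by
          rw [add_mul]; exact add_le_add (abs_sub_le f x y) (abs_sub_le g x y)
  norm_eq_zero_iff f := by
    constructor
    · intro h
      refine ext' fun x => ?_
      have hx := abs_sub_le f x o
      rw [h, zero_mul, map_base, sub_zero] at hx
      rw [zero_apply]
      exact abs_nonpos_iff.1 hx
    · rintro rfl
      refine le_antisymm (norm_le_of_forall le_rfl fun x y => ?_) (norm_nonneg' _)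
      simp [zero_apply]

noncomputable instance : NormedAddCommGroup (LipZero o) :=
  NormedAddCommGroup.ofCore normedSpaceCore

noncomputable instance : NormedSpace ℝ (LipZero o) :=
  NormedSpace.ofCore normedSpaceCore

end LipZero

/-! ### The Lipschitz-free space -/

/-- The evaluation functional `δ_x : f ↦ f x` on `Lip₀(M)`. -/
noncomputable def lipEval (o x : M) : StrongDual ℝ (LipZero o) :=
  LinearMap.mkContinuous
    { toFun := fun f => f x
      map_add' := fun f g => LipZero.add_apply f g x
      map_smul' := fun c f => LipZero.smul_apply c f x } (dist x o) fun f => by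
    have h := LipZero.abs_sub_le f x o
    rw [LipZero.map_base, sub_zero] at h
    rw [mul_comm]
    exact h

/-- The Lipschitz-free space `F(M)`: the norm-closed linear span of the evaluation functionals in the
dual of `Lip₀(M)`, with the norm of that dual. -/
noncomputable abbrev LipFree (o : M) : Submodule ℝ (StrongDual ℝ (LipZero o)) :=
  (Submodule.span ℝ (Set.range (lipEval o))).topologicalClosure

end LipZero

/-!
The argument rests on the molecules `(δ_x - δ_y) / d(x, y)`, which norm `Lip₀(M)`; as `Lip₀(M)` is the
dual of `F(M)` (`lipZeroDuality`), the bidual of `F(M)` is the dual of `Lip₀(M)`.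

*Geometry.* In a compact metrically convex space a maximal chain of a metric segment is an isometric
copy of an interval (`IsMetricallyConvex.exists_isometric_segment`), so that metric convexity is the
same as being geodesic.

*Metric convexity excludes the special points.* Along geodesics, a Lipschitz function whose norm
exceeds `c` has slope more than `c` at arbitrarily small scales near infinitely many points
(`infinite_steepPoints`). Changing a function near many such points, one at a time, gives the Daugavet
property, because the changes have disjoint supports and one of them is therefore almost invisible to
a given functional. Bumps at every other one of a sequence of such points give a direction in which
the norm has no derivative. A preserved extreme point is by Milman's theorem a weak* limit of
molecules; by compactness it is a molecule, as an element of `F(M)` supported at one point is zero,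
and a point of `[x, y]` splits the molecule of `x` and `y`.

*Fréchet differentiability is the weakest singularity to be excluded.* By Šmulian's lemma, a Fréchet
derivative of the norm of `Lip₀(M)` is a norm limit of molecules, hence a strongly exposed and a
preserved extreme point of the ball of `F(M)`; conversely, a strongly exposed point yields a point of
Fréchet differentiability. The Daugavet equation also fails at a point of Fréchet differentiability.

*Spaces that are not metrically convex.* By `exists_gap_of_not_isMetricallyConvex`, a variational
argument, there are `x ≠ y` and `ε > 0` with
`d(x, y) + ε min(d(x, z), d(z, y)) ≤ d(x, z) + d(z, y)` for all `z`. This gap leaves room for a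
function that attains its Lipschitz constant only at `(x, y)`, even asymptotically, and there the norm
is Fréchet differentiable (`exists_differentiableAt_norm_of_gap`).
-/

/-! ### Metric convexity and geodesics -/

section Geodesics

variable {M : Type*} [MetricSpace M]

/-- Metric convexity in Menger's sense: every metric segment with distinct end points contains a
third point. -/
def IsMetricallyConvex (M : Type*) [MetricSpace M] : Prop :=
  ∀ x y : M, x ≠ y → (metricSegment x y \ {x, y}).Nonempty

/-- Menger's theorem for compact spaces. A maximal chain of the metric segment `[x, y]`, ordered by
the distance to `x`, is isometric to a compact subset of `[0, d(x, y)]`; a gap in that subset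
could be filled by a further point, so the chain is an isometric copy of the whole interval. -/
theorem IsMetricallyConvex.exists_isometric_segment [CompactSpace M] (hM : IsMetricallyConvex M)
    (x y : M) : ∃ σ : ℝ → M, σ 0 = x ∧ σ (dist x y) = y ∧
      ∀ s ∈ Set.Icc 0 (dist x y), ∀ t ∈ Set.Icc 0 (dist x y), dist (σ s) (σ t) = |s - t| := by
  let r : M → M → Prop := fun u v => dist x u + dist u v + dist v y = dist x y
  obtain ⟨C, hC, hxyC⟩ : ∃ C, IsMaxChain r C ∧ {x, y} ⊆ C := by
    refine IsChain.exists_maxChain ?_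
    rintro a (rfl | rfl) b (rfl | rfl) hab
    · exact absurd rfl hab
    · left; simp [r]
    · right; simp [r]
    · exact absurd rfl hab
  have hxC : x ∈ C := hxyC (by simp)
  have hyC : y ∈ C := hxyC (by simp)
  have hseg : ∀ u ∈ C, dist x u + dist u y = dist x y := by
    intro u hu
    rcases eq_or_ne x u with rfl | hxu
    · simp
    · rcases hC.1 hxC hu hxu with h | h
      · simpa [r] using h
      · have h0 : dist x u = 0 := by
          have := @dist_nonneg _ _ x u
          simp only [r, dist_comm u x] at h
          linarith
        exact absurd (dist_eq_zero.1 h0) hxu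
  have hCr : ∀ u ∈ C, ∀ v ∈ C, dist u v = |dist x u - dist x v| := by
    have key : ∀ u ∈ C, ∀ v ∈ C, r u v → dist u v = |dist x u - dist x v| := by
      intro u hu v hv h
      have h1 := hseg u hu
      have h2 := hseg v hv
      have h3 := @dist_nonneg _ _ u v
      simp only [r] at h
      rw [abs_of_nonpos (by linarith)]
      linarith
    intro u hu v hv
    rcases eq_or_ne u v with rfl | huv
    · simp
    · rcases hC.1 hu hv huv with h | h
      · exact key u hu v hv h
      · rw [dist_comm, abs_sub_comm]; exact key v hv u hu h
  have hadd : ∀ w, dist x w + dist w y = dist x y →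
      (∀ u ∈ C, dist w u = |dist x w - dist x u|) → w ∈ C := by
    intro w hw hwC
    have hch : IsChain r (insert w C) := by
      refine hC.1.insert fun b hb _ => ?_
      have h1 := hwC b hb
      have h2 := hseg b hb
      simp only [r]
      rcases le_total (dist x w) (dist x b) with h | h
      · left; rw [abs_of_nonpos (by linarith)] at h1; linarith
      · right; rw [abs_of_nonneg (by linarith)] at h1; rw [dist_comm b w]; linarith
    rw [hC.2 hch (Set.subset_insert w C)]
    exact Set.mem_insert w C
  have hclosed : IsClosed C := by
    refine isClosed_of_closure_subset fun w hw => hadd w ?_ fun u hu => ?_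
    · have hcl : IsClosed {w : M | dist x w + dist w y = dist x y} :=
        isClosed_eq (by fun_prop) (by fun_prop)
      exact closure_minimal (fun w hw => hseg w hw) hcl hw
    · have hcl : IsClosed {w : M | dist w u = |dist x w - dist x u|} :=
        isClosed_eq (by fun_prop) (by fun_prop)
      exact closure_minimal (fun w hw => hCr w hw u hu) hcl hw
  have hsurj : ∀ t ∈ Set.Icc 0 (dist x y), ∃ u ∈ C, dist x u = t := by
    intro t ht
    by_contra! hne
    obtain ⟨u, ⟨huC, hut⟩, humax⟩ := (hclosed.inter
      (isClosed_le (continuous_const.dist continuous_id) continuous_const :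
        IsClosed {u : M | dist x u ≤ t})).isCompact.exists_isMaxOn ⟨x, hxC, by simpa using ht.1⟩
      (f := fun u => dist x u) (by fun_prop)
    obtain ⟨v, ⟨hvC, hvt⟩, hvmin⟩ := (hclosed.inter
      (isClosed_le continuous_const (continuous_const.dist continuous_id) :
        IsClosed {u : M | t ≤ dist x u})).isCompact.exists_isMinOn ⟨y, hyC, ht.2⟩
      (f := fun u => dist x u) (by fun_prop)
    simp only [Set.mem_ofPred_eq] at hut hvt
    have hut' : dist x u < t := lt_of_le_of_ne hut (hne u huC)
    have hvt' : t < dist x v := lt_of_le_of_ne hvt (hne v hvC).symm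
    have huv : u ≠ v := by rintro rfl; linarith
    obtain ⟨w, hw, hwne⟩ := hM u v huv
    simp only [Set.mem_insert_iff, Set.mem_singleton_iff, not_or] at hwne
    have hw' : dist u w + dist w v = dist u v := hw
    have huv' := hCr u huC v hvC
    rw [abs_of_neg (by linarith)] at huv'
    have hu := hseg u huC
    have hv := hseg v hvC
    have t1 := dist_triangle x u w
    have t2 := dist_triangle w v y
    have t3 := dist_triangle x w y
    have hxw : dist x w = dist x u + dist u w := by linarith
    have hwy : dist w y = dist w v + dist v y := by linarith
    have hwC : w ∈ C := by
      refine hadd w (by linarith) fun c hc => ?_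
      have hcs := hseg c hc
      rcases le_total (dist x c) t with h | h
      · have hcu : dist x c ≤ dist x u := humax ⟨hc, h⟩
        have h1 := hCr u huC c hc
        rw [abs_of_nonneg (by linarith)] at h1
        have h2 := dist_triangle w u c
        have h3 := dist_triangle x c w
        have h4 := @dist_nonneg _ _ u w
        rw [dist_comm w u] at h2
        rw [dist_comm c w] at h3
        rw [abs_of_nonneg (by linarith)]
        linarith
      · have hcv : dist x v ≤ dist x c := hvmin ⟨hc, h⟩
        have h1 := hCr v hvC c hc
        rw [abs_of_nonpos (by linarith)] at h1
        have h2 := dist_triangle w v c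
        have h3 := dist_triangle x w c
        have h4 := @dist_nonneg _ _ w v
        rw [abs_of_nonpos (by linarith)]
        linarith
    have p1 : 0 < dist u w := dist_pos.2 (Ne.symm hwne.1)
    have p2 : 0 < dist w v := dist_pos.2 hwne.2
    rcases le_total (dist x w) t with h | h
    · have : dist x w ≤ dist x u := humax ⟨hwC, h⟩
      linarith
    · have : dist x v ≤ dist x w := hvmin ⟨hwC, h⟩
      linarith
  have : Nonempty M := ⟨x⟩
  choose! σ hσC hσ using hsurj
  have h0 : (0 : ℝ) ∈ Set.Icc 0 (dist x y) := ⟨le_rfl, dist_nonneg⟩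
  have hD : dist x y ∈ Set.Icc 0 (dist x y) := ⟨dist_nonneg, le_rfl⟩
  refine ⟨σ, ?_, ?_, fun s hs t ht => ?_⟩
  · exact (dist_eq_zero.1 (hσ 0 h0)).symm
  · have h1 := hseg _ (hσC _ hD)
    rw [hσ _ hD] at h1
    exact dist_eq_zero.1 (by linarith)
  · rw [hCr _ (hσC s hs) _ (hσC t ht), hσ s hs, hσ t ht]

theorem edist_le_curveLength {x y : M} (γ : Path x y) : edist x y ≤ curveLength γ := by
  have h := eVariationOn.edist_le (γ : unitInterval → M) (Set.mem_univ 0) (Set.mem_univ 1)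
  rwa [γ.source, γ.target] at h

theorem IsMetricallyConvex.isGeodesicSpace [CompactSpace M] (hM : IsMetricallyConvex M) :
    IsGeodesicSpace M := by
  intro x y
  refine ⟨?_, ?_⟩
  · obtain ⟨σ, hσ0, hσD, hσ⟩ := hM.exists_isometric_segment x y
    have hmem : ∀ t : unitInterval, (t : ℝ) * dist x y ∈ Set.Icc 0 (dist x y) := fun t =>
      ⟨mul_nonneg t.2.1 dist_nonneg, mul_le_of_le_one_left dist_nonneg t.2.2⟩
    have hlip : LipschitzWith (nndist x y) fun t : unitInterval => σ (t * dist x y) := by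
      refine LipschitzWith.of_dist_le_mul fun s t => ?_
      rw [hσ _ (hmem s) _ (hmem t), ← sub_mul, abs_mul, abs_of_nonneg (dist_nonneg (x := x)),
        mul_comm, coe_nndist, Subtype.dist_eq, Real.dist_eq]
    let γ : Path x y :=
      { toFun := fun t => σ (t * dist x y)
        continuous_toFun := hlip.continuous
        source' := by simp [hσ0]
        target' := by simp [hσD] }
    have hid : eVariationOn (id : unitInterval → unitInterval) Set.univ ≤ 1 := by
      have h := MonotoneOn.eVariationOn_eq (f := fun t : unitInterval => (t : ℝ)) (s := Set.univ)
        (fun a _ b _ hab => hab) (Set.mem_univ 0) (Set.mem_univ 1)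
      have huniv : (Set.univ : Set unitInterval) ∩ Set.Icc 0 1 = Set.univ := by
        exact Set.eq_univ_of_forall fun t => ⟨trivial, t.2.1, t.2.2⟩
      rw [huniv] at h
      refine le_of_eq (Eq.trans ?_ (h.trans (by simp)))
      rfl
    have hle : curveLength γ ≤ edist x y := by
      have h := (hlip.lipschitzOnWith (s := Set.univ)).comp_eVariationOn_le
        (g := (id : unitInterval → unitInterval)) (s := Set.univ) (Set.mapsTo_univ _ _)
      calc curveLength γ ≤ nndist x y * eVariationOn (id : unitInterval → unitInterval) Set.univ :=
            h
        _ ≤ nndist x y * 1 := by gcongr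
        _ = edist x y := by rw [mul_one, edist_nndist]
    exact ⟨γ, le_antisymm hle (edist_le_curveLength γ), edist_ne_top x y⟩
  · rintro ℓ ⟨γ, rfl, -⟩
    exact edist_le_curveLength γ

theorem IsGeodesicSpace.isMetricallyConvex (hM : IsGeodesicSpace M) : IsMetricallyConvex M := by
  intro x y hxy
  obtain ⟨γ, hγ, -⟩ := (hM x y).1
  have hD : 0 < dist x y := dist_pos.2 hxy
  -- a point of the curve that is half way from `x`
  obtain ⟨t, ht⟩ : ∃ t : unitInterval, dist x (γ t) = dist x y / 2 := by
    have hc : Continuous fun t : unitInterval => dist x (γ t) := by fun_prop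
    have h := intermediate_value_univ (0 : unitInterval) 1 hc
    rw [γ.source, γ.target, dist_self] at h
    exact h ⟨by linarith, by linarith⟩
  have hlen : edist x (γ t) + edist (γ t) y ≤ edist x y := by
    have h1 := eVariationOn.edist_le (γ : unitInterval → M) (s := Set.Iic t) (x := 0) (y := t)
      t.2.1 Set.self_mem_Iic
    have h2 := eVariationOn.edist_le (γ : unitInterval → M) (s := Set.Ici t) (x := t) (y := 1)
      Set.self_mem_Ici t.2.2
    have h3 := eVariationOn.add_le_union (γ : unitInterval → M) (s := Set.Iic t) (t := Set.Ici t)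
      fun a ha b hb => le_trans ha hb
    rw [γ.source] at h1
    rw [γ.target] at h2
    calc edist x (γ t) + edist (γ t) y ≤ _ := add_le_add h1 h2
      _ ≤ _ := h3
      _ ≤ curveLength γ := eVariationOn.mono _ (Set.subset_univ _)
      _ = edist x y := hγ
  have hlen' : dist x (γ t) + dist (γ t) y ≤ dist x y := by
    rw [edist_dist, edist_dist, edist_dist, ← ENNReal.ofReal_add dist_nonneg dist_nonneg] at hlen
    exact (ENNReal.ofReal_le_ofReal_iff dist_nonneg).1 hlen
  refine ⟨γ t, le_antisymm hlen' (dist_triangle _ _ _), ?_⟩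
  rintro (h | h)
  · rw [h, dist_self] at ht; linarith
  · rw [Set.mem_singleton_iff] at h; rw [h] at ht; linarith

/-- If a compact space is not metrically convex, then it has a pair of distinct points whose metric
segment is trivial in a quantitative way. The pair minimizes
`d(u, v) + (1 - ε) (d(x, u) + d(v, y))`, where `[x, y] = {x, y}`, among the pairs that are not too
close; for small `ε` the minimizer is far from the constraint, so that one of its points may be
exchanged for any point of the space that is close to it. -/
theorem exists_gap_of_not_isMetricallyConvex [CompactSpace M] (hM : ¬ IsMetricallyConvex M) :
    ∃ x y : M, x ≠ y ∧ ∃ ε > 0, ε < 1 ∧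
      ∀ z, dist x y + ε * min (dist x z) (dist z y) ≤ dist x z + dist z y := by
  unfold IsMetricallyConvex at hM
  push Not at hM
  obtain ⟨x, y, hxy, hseg⟩ := hM
  set D := dist x y with hDdef
  have hD : 0 < D := dist_pos.2 hxy
  have hseg' : ∀ z, dist x z + dist z y = D → z = x ∨ z = y := by
    intro z hz
    by_contra hne
    have : z ∈ metricSegment x y \ {x, y} := ⟨hz, by simpa using hne⟩
    rw [hseg] at this
    exact this
  -- pairs at an intermediate distance have a definite excess
  obtain ⟨η, hη, hexc⟩ : ∃ η > 0, ∀ u v : M, D / 4 ≤ dist u v → dist u v ≤ D / 2 →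
      D + η ≤ dist x u + dist u v + dist v y := by
    let K : Set (M × M) := {p | D / 4 ≤ dist p.1 p.2 ∧ dist p.1 p.2 ≤ D / 2}
    have hK : IsCompact K :=
      (IsClosed.inter (isClosed_le continuous_const continuous_dist)
        (isClosed_le continuous_dist continuous_const)).isCompact
    rcases K.eq_empty_or_nonempty with hKe | hKn
    · refine ⟨1, one_pos, fun u v h1 h2 => ?_⟩
      have : (u, v) ∈ K := ⟨h1, h2⟩
      rw [hKe] at this
      exact this.elim
    · obtain ⟨⟨u, v⟩, ⟨huv1, huv2⟩, hmin⟩ := hK.exists_isMinOn hKn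
        (f := fun p : M × M => dist x p.1 + dist p.1 p.2 + dist p.2 y) (by fun_prop)
      simp only at huv1 huv2
      refine ⟨dist x u + dist u v + dist v y - D, ?_, fun u' v' h1 h2 => ?_⟩
      · by_contra hle
        have t1 := dist_triangle x u y
        have t2 := dist_triangle u v y
        have t3 := dist_triangle x v y
        have t4 := dist_triangle x u v
        have hu := hseg' u (by linarith)
        have hv := hseg' v (by linarith)
        rcases hu with rfl | rfl <;> rcases hv with rfl | rfl
        · simp at huv1; linarith
        · linarith
        · rw [dist_comm u v] at hle; linarith [dist_comm u v]
        · simp at huv1; linarith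
      · have : dist x u + dist u v + dist v y ≤ dist x u' + dist u' v' + dist v' y :=
          hmin (show (u', v') ∈ K from ⟨h1, h2⟩)
        linarith
  obtain ⟨R, hR, hRbd⟩ : ∃ R > 0, ∀ u v : M, dist u v ≤ R := by
    obtain ⟨R, hR⟩ := Metric.isBounded_iff.1 (isCompact_univ (X := M)).isBounded
    exact ⟨max R 1, by positivity, fun u v =>
      (hR (Set.mem_univ u) (Set.mem_univ v)).trans (le_max_left _ _)⟩
  obtain ⟨ε, hε, hε1, hεR⟩ : ∃ ε > 0, ε < 1 ∧ ε * (2 * R) < η := by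
    refine ⟨min (1 / 2) (η / (4 * R)), by positivity, by
      have := min_le_left (1 / 2) (η / (4 * R)); linarith, ?_⟩
    calc min (1 / 2) (η / (4 * R)) * (2 * R) ≤ η / (4 * R) * (2 * R) := by
          gcongr; exact min_le_right _ _
      _ = η / 2 := by field_simp; ring
      _ < η := by linarith
  let K : Set (M × M) := {p | D / 4 ≤ dist p.1 p.2}
  have hK : IsCompact K := (isClosed_le continuous_const continuous_dist).isCompact
  have hxyK : (x, y) ∈ K := show D / 4 ≤ dist x y by linarith
  obtain ⟨⟨u, v⟩, huvK, hmin⟩ := hK.exists_isMinOn ⟨_, hxyK⟩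
    (f := fun p : M × M => dist p.1 p.2 + (1 - ε) * (dist x p.1 + dist p.2 y)) (by fun_prop)
  have hmin' : ∀ u' v', D / 4 ≤ dist u' v' →
      dist u v + (1 - ε) * (dist x u + dist v y) ≤
        dist u' v' + (1 - ε) * (dist x u' + dist v' y) := fun u' v' h =>
    hmin (show (u', v') ∈ K from h)
  have huv4 : D / 4 ≤ dist u v := huvK
  have huv2 : D / 2 < dist u v := by
    by_contra! hle
    have h1 := hexc u v huv4 hle
    have h2 := hmin' x y hxyK
    simp only [dist_self, add_zero, mul_zero] at h2
    nlinarith [hRbd x u, hRbd v y]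
  refine ⟨u, v, fun h => by subst h; simp at huv2; linarith, ε, hε, hε1, fun z => ?_⟩
  have t0 := dist_triangle u z v
  rcases le_total (dist u z) (dist z v) with h | h
  · rw [min_eq_left h]
    have h1 := hmin' z v (by linarith)
    nlinarith [dist_triangle x u z]
  · rw [min_eq_right h]
    have h1 := hmin' u z (by linarith)
    nlinarith [dist_triangle z v y]

end Geodesics

/-! ### Molecules and the duality between `F(M)` and `Lip₀(M)` -/

section Duality

variable {M : Type*} [MetricSpace M] {o : M}

/-- The element `f - f(o)` of `Lip₀(M)` defined by a Lipschitz function `f`. -/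
def LipZero.ofLipschitz (o : M) {K : ℝ≥0} {f : M → ℝ} (hf : LipschitzWith K f) : LipZero o :=
  ⟨fun z => f z - f o, ⟨K, LipschitzWith.of_dist_le_mul fun x y => by
    simpa using hf.dist_le_mul x y⟩, sub_self _⟩

theorem LipZero.ofLipschitz_apply {K : ℝ≥0} {f : M → ℝ} (hf : LipschitzWith K f) (x : M) :
    LipZero.ofLipschitz o hf x = f x - f o := rfl

theorem LipZero.norm_ofLipschitz_le {K : ℝ≥0} {f : M → ℝ} (hf : LipschitzWith K f) :
    ‖LipZero.ofLipschitz o hf‖ ≤ K :=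
  LipZero.norm_le_of_forall K.2 fun x y => by
    simpa [LipZero.ofLipschitz_apply, Real.dist_eq] using hf.dist_le_mul x y

theorem LipZero.lipschitzWith (f : LipZero o) : LipschitzWith ‖f‖₊ f :=
  LipschitzWith.of_dist_le_mul fun x y => LipZero.abs_sub_le f x y

/-- The dual of a normed space, with the topology and the module structure that come from its norm;
for the subspace `F(M)` this fixes the instances. -/
abbrev NormedDual (X : Type*) [NormedAddCommGroup X] [NormedSpace ℝ X] : Type _ := StrongDual ℝ X

/-- The molecule `(δ_x - δ_y) / d(x, y)`, which is `0` for `x = y`. -/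
noncomputable def molecule (o x y : M) : StrongDual ℝ (LipZero o) :=
  (dist x y)⁻¹ • (lipEval o x - lipEval o y)

theorem molecule_apply (x y : M) (f : LipZero o) : molecule o x y f = (f x - f y) / dist x y := by
  rw [div_eq_inv_mul]; rfl

theorem molecule_swap (x y : M) : molecule o y x = -molecule o x y := by
  ext f
  rw [neg_apply, molecule_apply, molecule_apply, dist_comm, ← neg_div, neg_sub]

theorem lipEval_mem_lipFree (x : M) : lipEval o x ∈ LipFree o :=
  Submodule.le_topologicalClosure _ (Submodule.subset_span ⟨x, rfl⟩)

theorem molecule_mem_lipFree (x y : M) : molecule o x y ∈ LipFree o :=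
  Submodule.smul_mem _ _ (Submodule.sub_mem _ (lipEval_mem_lipFree x) (lipEval_mem_lipFree y))

theorem norm_lipEval_sub_le (x y : M) : ‖lipEval o x - lipEval o y‖ ≤ dist x y :=
  ContinuousLinearMap.opNorm_le_bound _ dist_nonneg fun f => by
    rw [mul_comm]; exact LipZero.abs_sub_le f x y

theorem norm_molecule_le (x y : M) : ‖molecule o x y‖ ≤ 1 := by
  rw [molecule, norm_smul, norm_inv, Real.norm_of_nonneg dist_nonneg]
  calc (dist x y)⁻¹ * ‖lipEval o x - lipEval o y‖ ≤ (dist x y)⁻¹ * dist x y := by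
        gcongr; exact norm_lipEval_sub_le x y
    _ ≤ 1 := inv_mul_le_one

theorem abs_molecule_le (x y : M) (f : LipZero o) : |molecule o x y f| ≤ ‖f‖ := by
  simpa using (molecule o x y).le_of_opNorm_le (norm_molecule_le x y) f

theorem exists_lt_molecule {f : LipZero o} {c : ℝ} (hc : 0 ≤ c) (h : c < ‖f‖) :
    ∃ x y, x ≠ y ∧ c < molecule o x y f := by
  by_contra! hle
  refine h.not_ge (LipZero.norm_le_of_forall hc fun x y => ?_)
  rcases eq_or_ne x y with rfl | hxy
  · simp
  · have key : ∀ x y : M, x ≠ y → f x - f y ≤ c * dist x y := fun x y hxy => by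
      have := hle x y hxy
      rwa [molecule_apply, div_le_iff₀ (dist_pos.2 hxy)] at this
    rw [abs_le]
    have h1 := key x y hxy
    have h2 := key y x hxy.symm
    rw [dist_comm] at h2
    constructor <;> linarith

theorem continuousAt_molecule {x y : M} (hxy : x ≠ y) :
    ContinuousAt (fun p : M × M => molecule o p.1 p.2) (x, y) := by
  have hδ : Continuous (lipEval o) := LipschitzWith.continuous (K := 1) <|
    LipschitzWith.of_dist_le_mul fun x y => by
      rw [dist_eq_norm, NNReal.coe_one, one_mul]; exact norm_lipEval_sub_le x y
  unfold molecule
  have h1 : ContinuousAt (fun p : M × M => (dist p.1 p.2)⁻¹) (x, y) :=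
    continuous_dist.continuousAt.inv₀ (dist_pos.2 hxy).ne'
  have h2 : ContinuousAt (fun p : M × M => lipEval o p.1 - lipEval o p.2) (x, y) :=
    ((hδ.comp continuous_fst).sub (hδ.comp continuous_snd)).continuousAt
  exact h1.smul h2

theorem lipZero_nontrivial [Nontrivial M] : Nontrivial (LipZero o) := by
  obtain ⟨x, y, hxy⟩ := exists_pair_ne M
  refine ⟨LipZero.ofLipschitz o (LipschitzWith.dist_left x), 0, fun h => ?_⟩
  have hx : LipZero.ofLipschitz o (LipschitzWith.dist_left x) x = 0 := by rw [h]; rfl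
  have hy : LipZero.ofLipschitz o (LipschitzWith.dist_left x) y = 0 := by rw [h]; rfl
  rw [LipZero.ofLipschitz_apply] at hx hy
  rw [dist_self] at hx
  exact hxy (dist_eq_zero.1 (by rw [dist_comm]; linarith))

/-- The isometric identification of `Lip₀(M)` with the dual of `F(M)`. A functional `φ` on `F(M)`
corresponds to the function `x ↦ φ(δ_x)`. -/
noncomputable def lipZeroDuality (o : M) : LipZero o ≃ₗᵢ[ℝ] NormedDual (LipFree o) :=
  let L : LipZero o →ₗ[ℝ] NormedDual (LipFree o) :=
    { toFun := fun f =>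
        (NormedSpace.inclusionInDoubleDual ℝ (LipZero o) f).comp (LipFree o).subtypeL
      map_add' := fun f g => by ext μ; simp
      map_smul' := fun c f => by ext μ; simp }
  have hle : ∀ f, ‖L f‖ ≤ ‖f‖ := fun f =>
    ContinuousLinearMap.opNorm_le_bound _ (norm_nonneg f) fun μ => by
      rw [mul_comm]; exact μ.1.le_opNorm f
  have hδ : ∀ (φ : NormedDual (LipFree o)) (x y : M),
      |φ ⟨lipEval o x, lipEval_mem_lipFree x⟩ - φ ⟨lipEval o y, lipEval_mem_lipFree y⟩| ≤
        ‖φ‖ * dist x y := fun φ x y => by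
    rw [← map_sub]
    refine (φ.le_opNorm _).trans ?_
    gcongr
    exact norm_lipEval_sub_le x y
  have hge : ∀ f, ‖f‖ ≤ ‖L f‖ := fun f =>
    LipZero.norm_le_of_forall (norm_nonneg _) fun x y => hδ (L f) x y
  LinearIsometryEquiv.ofSurjective
    { L with norm_map' := fun f => le_antisymm (hle f) (hge f) } <| by
    intro φ
    have hlip : LipschitzWith ‖φ‖₊ fun x => φ ⟨lipEval o x, lipEval_mem_lipFree x⟩ :=
      LipschitzWith.of_dist_le_mul fun x y => hδ φ x y
    have h0 : lipEval o o = 0 := by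
      ext f; exact LipZero.map_base f
    refine ⟨LipZero.ofLipschitz o hlip, ?_⟩
    -- the two functionals agree on the evaluations, whose span is dense
    have hφ : ∀ x, φ ⟨lipEval o x, lipEval_mem_lipFree x⟩ =
        LipZero.ofLipschitz o hlip x := fun x => by
      have h1 : φ ⟨lipEval o o, lipEval_mem_lipFree o⟩ = 0 := by
        have : (⟨lipEval o o, lipEval_mem_lipFree o⟩ : LipFree o) = 0 := Subtype.ext h0
        rw [this, map_zero]
      rw [LipZero.ofLipschitz_apply, h1, sub_zero]
    have hspan : ∀ (ν : StrongDual ℝ (LipZero o)) (hν : ν ∈ Submodule.span ℝ (Set.range (lipEval o))),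
        ν (LipZero.ofLipschitz o hlip) = φ ⟨ν, Submodule.le_topologicalClosure _ hν⟩ := by
      intro ν hν
      induction hν using Submodule.span_induction with
      | mem ν hν => obtain ⟨x, rfl⟩ := hν; exact (hφ x).symm
      | zero => exact (map_zero φ).symm
      | add a b ha hb iha ihb =>
        rw [add_apply, iha, ihb, ← map_add]; rfl
      | smul c a ha iha =>
        rw [smul_apply, iha, ← map_smul]; rfl
    refine ContinuousLinearMap.ext fun μ => ?_
    have hclosed : IsClosed {ν : LipFree o | L (LipZero.ofLipschitz o hlip) ν = φ ν} :=
      isClosed_eq (ContinuousLinearMap.continuous _) φ.continuous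
    have hdense : μ ∈ closure {ν : LipFree o | (ν : StrongDual ℝ (LipZero o)) ∈
        Submodule.span ℝ (Set.range (lipEval o))} := by
      rw [Metric.mem_closure_iff]
      intro ε hε
      obtain ⟨ν, hν, hd⟩ := Metric.mem_closure_iff.1 μ.2 ε hε
      exact ⟨⟨ν, Submodule.le_topologicalClosure _ hν⟩, hν, hd⟩
    exact closure_minimal (fun ν hν => hspan ν.1 hν) hclosed hdense

theorem lipZeroDuality_apply (f : LipZero o) (μ : LipFree o) : lipZeroDuality o f μ = μ.1 f := rfl

/-- As the bidual of `F(M)` is the dual of `Lip₀(M)`, the preserved extreme points of the ball of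
`F(M)` are the elements of `F(M)` that are extreme in the dual ball of `Lip₀(M)`. -/
theorem isPreservedExtremePoint_iff (μ : LipFree o) :
    IsPreservedExtremePoint μ ↔ (μ : StrongDual ℝ (LipZero o)) ∈
      Set.extremePoints ℝ (Metric.closedBall (0 : StrongDual ℝ (LipZero o)) 1) := by
  let e : NormedDual (NormedDual (LipFree o)) ≃L[ℝ] StrongDual ℝ (LipZero o) :=
    (lipZeroDuality o).symm.toContinuousLinearEquiv.arrowCongr (ContinuousLinearEquiv.refl ℝ ℝ)
  have he : ∀ a f, e a f = a (lipZeroDuality o f) := fun a f => rfl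
  have hes : ∀ b φ, e.symm b φ = b ((lipZeroDuality o).symm φ) := fun b φ => rfl
  have hball : e '' Metric.closedBall 0 1 = Metric.closedBall 0 1 := by
    refine Set.Subset.antisymm ?_ ?_
    · rintro _ ⟨a, ha, rfl⟩
      rw [mem_closedBall_zero_iff] at ha ⊢
      refine ContinuousLinearMap.opNorm_le_bound _ zero_le_one fun f => ?_
      rw [he, ← (lipZeroDuality o).norm_map f]
      exact a.le_of_opNorm_le ha _
    · intro b hb
      refine ⟨e.symm b, ?_, e.apply_symm_apply b⟩
      rw [mem_closedBall_zero_iff] at hb ⊢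
      refine ContinuousLinearMap.opNorm_le_bound _ zero_le_one fun φ => ?_
      rw [hes, ← (lipZeroDuality o).symm.norm_map φ]
      exact b.le_of_opNorm_le hb _
  have hμ : e (NormedSpace.inclusionInDoubleDual ℝ (LipFree o) μ) = μ := by
    ext f; rfl
  rw [IsPreservedExtremePoint, ← hball, ← image_extremePoints, ← hμ]
  exact (e.injective.mem_set_image).symm

end Duality

/-! ### Fréchet differentiability of norms -/

section Smulian

variable {X : Type*} [NormedAddCommGroup X] [NormedSpace ℝ X]

theorem HasFDerivAt.exists_norm_add_le {f : X} {φ : StrongDual ℝ X}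
    (h : HasFDerivAt (fun g : X => ‖g‖) φ f) {η : ℝ} (hη : 0 < η) :
    ∃ r > 0, ∀ k : X, ‖k‖ ≤ r → ‖f + k‖ ≤ ‖f‖ + φ k + η * ‖k‖ := by
  rw [hasFDerivAt_iff_isLittleO_nhds_zero, Asymptotics.isLittleO_iff] at h
  obtain ⟨r, hr, hball⟩ := Metric.eventually_nhds_iff.1 (h hη)
  refine ⟨r / 2, half_pos hr, fun k hk => ?_⟩
  have := hball (y := k) (by rw [dist_zero_right]; linarith)
  have := le_abs_self (‖f + k‖ - ‖f‖ - φ k)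
  rw [Real.norm_eq_abs] at *
  linarith

theorem HasFDerivAt.apply_self_of_norm {f : X} {φ : StrongDual ℝ X}
    (h : HasFDerivAt (fun g : X => ‖g‖) φ f) : φ f = ‖f‖ := by
  have := h.differentiableAt.fderiv_norm_self
  rwa [h.fderiv] at this

theorem HasFDerivAt.norm_eq_one_of_norm [Nontrivial X] {f : X} {φ : StrongDual ℝ X}
    (h : HasFDerivAt (fun g : X => ‖g‖) φ f) : ‖φ‖ = 1 := by
  have := norm_fderiv_norm h.differentiableAt
  rwa [h.fderiv] at this

theorem ne_zero_of_differentiableAt_norm [Nontrivial X] {f : X}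
    (h : DifferentiableAt ℝ (fun g : X => ‖g‖) f) : f ≠ 0 := by
  rintro rfl
  exact not_differentiableAt_norm_zero X h

/-- One half of Šmulian's lemma: if the norm is Fréchet differentiable at `f`, then the functionals
of the dual ball that almost norm `f` are close to the derivative. -/
theorem HasFDerivAt.exists_norm_sub_le {f : X} {φ : StrongDual ℝ X}
    (h : HasFDerivAt (fun g : X => ‖g‖) φ f) {η : ℝ} (hη : 0 < η) :
    ∃ δ > 0, ∀ ψ : StrongDual ℝ X, ‖ψ‖ ≤ 1 → ‖f‖ - δ < ψ f → ‖ψ - φ‖ ≤ η := by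
  obtain ⟨r, hr, hle⟩ := h.exists_norm_add_le (half_pos hη)
  refine ⟨η / 2 * r, by positivity, fun ψ hψ hψf => ?_⟩
  have key : ∀ k : X, ‖k‖ = 1 → (ψ - φ) k ≤ η := by
    intro k hk
    have hrk : ‖r • k‖ = r := by rw [norm_smul, hk, mul_one, Real.norm_of_nonneg hr.le]
    have h1 := hle (r • k) hrk.le
    have h2 := (le_abs_self _).trans (ψ.le_of_opNorm_le hψ (f + r • k))
    rw [hrk, map_smul, smul_eq_mul] at h1
    rw [map_add, map_smul, smul_eq_mul, one_mul] at h2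
    rw [sub_apply]
    have h3 : r * (ψ k - φ k) ≤ r * η := by linarith
    exact le_of_mul_le_mul_left h3 hr
  refine ContinuousLinearMap.opNorm_le_of_unit_norm hη.le fun k hk => ?_
  rw [Real.norm_eq_abs, abs_le]
  have h1 := key k hk
  have h2 := key (-k) (by rwa [norm_neg])
  rw [map_neg] at h2
  constructor <;> linarith

/-- A point of Fréchet differentiability yields an extreme point of the dual ball. -/
theorem HasFDerivAt.mem_extremePoints_closedBall [Nontrivial X] {f : X} {φ : StrongDual ℝ X}
    (h : HasFDerivAt (fun g : X => ‖g‖) φ f) :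
    φ ∈ Set.extremePoints ℝ (Metric.closedBall (0 : StrongDual ℝ X) 1) := by
  have huniq : ∀ ψ : StrongDual ℝ X, ‖ψ‖ ≤ 1 → ‖f‖ ≤ ψ f → ψ = φ := by
    intro ψ hψ hψf
    have h0 : ‖ψ - φ‖ ≤ 0 := le_of_forall_pos_le_add fun η hη => by
      obtain ⟨δ, hδ, hle⟩ := h.exists_norm_sub_le hη
      rw [zero_add]
      exact hle ψ hψ (by linarith)
    exact sub_eq_zero.1 (norm_le_zero_iff.1 h0)
  rw [mem_extremePoints]
  refine ⟨by rw [mem_closedBall_zero_iff, h.norm_eq_one_of_norm], ?_⟩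
  rintro a ha b hb ⟨s, t, hs, ht, hst, hab⟩
  rw [mem_closedBall_zero_iff] at ha hb
  have haf := (le_abs_self _).trans (a.le_of_opNorm_le ha f)
  have hbf := (le_abs_self _).trans (b.le_of_opNorm_le hb f)
  have hφ := h.apply_self_of_norm
  rw [← hab, add_apply, smul_apply,
    smul_apply, smul_eq_mul, smul_eq_mul] at hφ
  have hs1 : s = 1 - t := by linarith
  subst hs1
  exact ⟨huniq a ha (by nlinarith), huniq b hb (by nlinarith)⟩

/-- If the norm has the Fréchet derivative `φ` at the unit vector `e`, then the rank-one operator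
`-φ ⊗ e` violates the Daugavet equation: a vector `h` of the ball with `‖h - φ(h) e‖` close to `2`
and `φ(h) ≥ 0` has `φ(h)` close to `1` and `‖h - e‖` close to `2`, so that `‖e - t h‖` is close to
`1 + t`, whereas the derivative predicts `1 - t`. -/
theorem HasDaugavetProperty.not_differentiableAt_norm [Nontrivial X] (hX : HasDaugavetProperty X)
    (f : X) : ¬ DifferentiableAt ℝ (fun g : X => ‖g‖) f := by
  intro hdiff
  have hf := ne_zero_of_differentiableAt_norm hdiff
  obtain ⟨φ, hφ⟩ := hdiff
  have hfn : 0 < ‖f‖ := norm_pos_iff.2 hf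
  have hφ1 : ‖φ‖ = 1 := hφ.norm_eq_one_of_norm
  set e : X := ‖f‖⁻¹ • f with hedef
  have he : ‖e‖ = 1 := norm_smul_inv_norm hf
  have hφe : φ e = 1 := by
    rw [hedef, map_smul, hφ.apply_self_of_norm, smul_eq_mul, inv_mul_cancel₀ hfn.ne']
  let T : X →L[ℝ] X := -(φ.smulRight e)
  have hT : ∀ x, T x = -(φ x • e) := fun x => rfl
  have hTn : ‖T‖ = 1 := by
    simp only [T]
    rw [norm_neg, ContinuousLinearMap.norm_smulRight_apply, hφ1, he, one_mul]
  have hrank : Module.finrank ℝ (LinearMap.range (T : X →ₗ[ℝ] X)) = 1 := by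
    have hrange : LinearMap.range (T : X →ₗ[ℝ] X) = Submodule.span ℝ {e} := by
      ext x
      rw [LinearMap.mem_range, Submodule.mem_span_singleton]
      constructor
      · rintro ⟨y, rfl⟩
        exact ⟨-φ y, by simp [hT]⟩
      · rintro ⟨a, rfl⟩
        exact ⟨-(a • e), by simp [hT, hφe]⟩
    rw [hrange]
    exact finrank_span_singleton (norm_pos_iff.1 (by rw [he]; exact one_pos))
  have hnorm := hX T hrank
  rw [hTn] at hnorm
  obtain ⟨r, hr, hle⟩ := hφ.exists_norm_add_le (η := 1 / 2) (by norm_num)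
  -- `t` is a step size for which the derivative at `e` is accurate up to `t / 2`
  set t : ℝ := min (r / ‖f‖) 1 with htdef
  have ht : 0 < t := by positivity
  have ht1 : t ≤ 1 := min_le_right _ _
  have htr : ‖f‖ * t ≤ r := by
    calc ‖f‖ * t ≤ ‖f‖ * (r / ‖f‖) := by gcongr; exact min_le_left _ _
      _ = r := by field_simp
  have hstep : ∀ h : X, ‖h‖ ≤ 1 → ‖e - t • h‖ ≤ 1 - t * φ h + t / 2 := by
    intro h hh
    have hk : ‖-((‖f‖ * t) • h)‖ ≤ ‖f‖ * t := by
      rw [norm_neg, norm_smul, Real.norm_of_nonneg (by positivity)]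
      exact mul_le_of_le_one_right (by positivity) hh
    have h1 := hle _ (hk.trans htr)
    have h2 : f + -((‖f‖ * t) • h) = ‖f‖ • (e - t • h) := by
      rw [smul_sub, hedef, smul_smul, smul_smul, mul_inv_cancel₀ hfn.ne', one_smul, sub_eq_add_neg]
    rw [h2, norm_smul, norm_norm, map_neg, map_smul, smul_eq_mul] at h1
    have h3 : ‖f‖ * ‖e - t • h‖ ≤ ‖f‖ * (1 - t * φ h + t / 2) := by linarith
    exact le_of_mul_le_mul_left h3 hfn
  -- almost attain the norm of `I + T`
  set ε : ℝ := t / 8 with hεdef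
  obtain ⟨h, hh1, hh2⟩ : ∃ h : X, ‖h‖ ≤ 1 ∧ 2 - ε < ‖h - φ h • e‖ := by
    by_contra! hcon
    have : ‖T + ContinuousLinearMap.id ℝ X‖ ≤ 2 - ε := by
      refine ContinuousLinearMap.opNorm_le_of_unit_norm (by linarith) fun x hx => ?_
      have := hcon x hx.le
      rwa [add_apply, ContinuousLinearMap.id_apply, hT, add_comm,
        ← sub_eq_add_neg]
    linarith
  obtain ⟨h, hh1, hh2, hφh⟩ : ∃ h : X, ‖h‖ ≤ 1 ∧ 2 - ε < ‖h - φ h • e‖ ∧ 0 ≤ φ h := by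
    rcases le_total 0 (φ h) with h0 | h0
    · exact ⟨h, hh1, hh2, h0⟩
    · refine ⟨-h, by rwa [norm_neg], ?_, by rw [map_neg]; linarith⟩
      rwa [map_neg, neg_smul, ← neg_sub', norm_neg]
  have hφle : φ h ≤ 1 := by
    have := (le_abs_self _).trans (φ.le_of_opNorm_le hφ1.le h)
    linarith
  have hφge : 1 - ε < φ h := by
    have h1 := norm_sub_le h (φ h • e)
    rw [norm_smul, he, mul_one, Real.norm_of_nonneg hφh] at h1
    linarith
  have hhe : 2 - 2 * ε < ‖h - e‖ := by
    have h1 : h - φ h • e = (h - e) + (1 - φ h) • e := by rw [sub_smul, one_smul]; abel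
    have h2 := norm_add_le (h - e) ((1 - φ h) • e)
    rw [← h1, norm_smul, he, mul_one, Real.norm_of_nonneg (by linarith)] at h2
    linarith
  have hlow : 1 + t - 2 * ε < ‖e - t • h‖ := by
    have h1 : h - e = (1 - t) • h - (e - t • h) := by rw [sub_smul, one_smul]; abel
    have h2 := norm_sub_le ((1 - t) • h) (e - t • h)
    rw [← h1, norm_smul, Real.norm_of_nonneg (by linarith)] at h2
    have h3 : (1 - t) * ‖h‖ ≤ 1 - t := mul_le_of_le_one_right (by linarith) hh1
    linarith
  have hup := hstep h hh1
  have : t * (1 - ε) ≤ t * φ h := by gcongr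
  have : t * ε ≤ 1 * ε := by gcongr
  linarith

end Smulian

/-! ### Fréchet differentiability of the norm of `Lip₀(M)` and strongly exposed points -/

section FreeSpaceSmulian

variable {M : Type*} [MetricSpace M] {o : M}

/-- The other half of Šmulian's lemma, for the norm of `Lip₀(M)`, which is the supremum over the
molecules. -/
theorem hasFDerivAt_norm_of_molecule {f : LipZero o} {μ : StrongDual ℝ (LipZero o)} (hf : ‖f‖ = 1)
    (hμ : ‖μ‖ ≤ 1) (hμf : μ f = 1)
    (h : ∀ η > 0, ∃ δ > 0, ∀ x y, x ≠ y → 1 - δ < molecule o x y f → ‖molecule o x y - μ‖ ≤ η) :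
    HasFDerivAt (fun g : LipZero o => ‖g‖) μ f := by
  rw [hasFDerivAt_iff_isLittleO_nhds_zero, Asymptotics.isLittleO_iff]
  intro η hη
  obtain ⟨δ, hδ, hclose⟩ := h η hη
  rw [Metric.eventually_nhds_iff]
  refine ⟨min (δ / 2) (1 / 2), by positivity, fun k hk => ?_⟩
  rw [dist_zero_right, lt_min_iff] at hk
  have hlow : 1 + μ k ≤ ‖f + k‖ := by
    have := (le_abs_self _).trans (μ.le_of_opNorm_le hμ (f + k))
    rwa [map_add, hμf, one_mul] at this
  have hμk := abs_le.1 (μ.le_of_opNorm_le hμ k)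
  have hup : ‖f + k‖ ≤ 1 + μ k + η * ‖k‖ := by
    by_contra! hlt
    have hηk : 0 ≤ η * ‖k‖ := by positivity
    obtain ⟨x, y, hxy, hm⟩ := exists_lt_molecule (by linarith [hk.2]) hlt
    rw [map_add] at hm
    have hmk := abs_le.1 (abs_molecule_le x y k)
    have hmf := (le_abs_self _).trans (abs_molecule_le x y f)
    have h1 := hclose x y hxy (by linarith [hk.1])
    have h2 := (le_abs_self _).trans ((molecule o x y - μ).le_of_opNorm_le h1 k)
    rw [sub_apply] at h2
    linarith
  rw [hf, Real.norm_eq_abs, abs_le]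
  have : 0 ≤ η * ‖k‖ := by positivity
  constructor <;> linarith

/-- Fréchet derivatives of the norm of `Lip₀(M)` are norm limits of molecules. -/
theorem mem_lipFree_of_hasFDerivAt_norm [Nontrivial M] {f : LipZero o}
    {φ : StrongDual ℝ (LipZero o)} (h : HasFDerivAt (fun g : LipZero o => ‖g‖) φ f) :
    φ ∈ LipFree o := by
  have : Nontrivial (LipZero o) := lipZero_nontrivial
  have hf : 0 < ‖f‖ := norm_pos_iff.2 (ne_zero_of_differentiableAt_norm h.differentiableAt)
  refine (Submodule.isClosed_topologicalClosure _).closure_subset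
    (Metric.mem_closure_iff.2 fun ε hε => ?_)
  obtain ⟨δ, hδ, hle⟩ := h.exists_norm_sub_le (half_pos hε)
  obtain ⟨x, y, -, hm⟩ := exists_lt_molecule (le_max_right (‖f‖ - δ) 0)
    (max_lt (by linarith) hf)
  refine ⟨molecule o x y, molecule_mem_lipFree x y, ?_⟩
  rw [dist_comm, dist_eq_norm]
  have := hle _ (norm_molecule_le x y) ((le_max_left _ _).trans_lt hm)
  linarith

theorem exists_isStronglyExposedPoint_of_differentiableAt [Nontrivial M] {f : LipZero o}
    (h : DifferentiableAt ℝ (fun g : LipZero o => ‖g‖) f) :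
    ∃ μ : LipFree o, IsStronglyExposedPoint μ := by
  have : Nontrivial (LipZero o) := lipZero_nontrivial
  have hf0 := ne_zero_of_differentiableAt_norm h
  have hf : 0 < ‖f‖ := norm_pos_iff.2 hf0
  obtain ⟨φ, hφ⟩ := h
  refine ⟨⟨φ, mem_lipFree_of_hasFDerivAt_norm hφ⟩, hφ.norm_eq_one_of_norm,
    lipZeroDuality o (‖f‖⁻¹ • f), ?_, fun u hu hlim => ?_⟩
  · rw [LinearIsometryEquiv.norm_map]; exact norm_smul_inv_norm hf0
  · simp only [lipZeroDuality_apply, (ContinuousLinearMap.map_smul), smul_eq_mul] at hlim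
    have hlim' : Tendsto (fun n => (u n).1 f) atTop (𝓝 ‖f‖) := by
      have := hlim.const_mul ‖f‖
      simpa only [mul_inv_cancel_left₀ hf.ne', hφ.apply_self_of_norm] using this
    rw [Metric.tendsto_atTop]
    intro ε hε
    obtain ⟨δ, hδ, hle⟩ := hφ.exists_norm_sub_le (half_pos hε)
    obtain ⟨N, hN⟩ := Filter.eventually_atTop.1
      (hlim'.eventually (lt_mem_nhds (show ‖f‖ - δ < ‖f‖ by linarith)))
    refine ⟨N, fun n hn => ?_⟩
    have h1 := hle (u n).1 (mem_closedBall_zero_iff.1 (hu n)) (hN n hn)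
    calc dist (u n) ⟨φ, _⟩ = ‖(u n).1 - φ‖ := dist_eq_norm (u n).1 φ
      _ ≤ ε / 2 := h1
      _ < ε := by linarith

theorem exists_isPreservedExtremePoint_of_differentiableAt [Nontrivial M] {f : LipZero o}
    (h : DifferentiableAt ℝ (fun g : LipZero o => ‖g‖) f) :
    ∃ μ : LipFree o, IsPreservedExtremePoint μ := by
  have : Nontrivial (LipZero o) := lipZero_nontrivial
  obtain ⟨φ, hφ⟩ := h
  exact ⟨⟨φ, mem_lipFree_of_hasFDerivAt_norm hφ⟩,
    (isPreservedExtremePoint_iff _).2 hφ.mem_extremePoints_closedBall⟩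

/-- A functional that strongly exposes `μ` attains its norm at `μ` or `-μ`: otherwise a multiple of
an almost norming vector has the same value as `μ` and a smaller norm. -/
theorem abs_apply_eq_one_of_stronglyExposing {X : Type*} [NormedAddCommGroup X] [NormedSpace ℝ X]
    {x : X} {f : StrongDual ℝ X} (hx : ‖x‖ = 1) (hf : ‖f‖ = 1)
    (h : ∀ u : ℕ → X, (∀ n, u n ∈ Metric.closedBall (0 : X) 1) →
      Tendsto (fun n => f (u n)) atTop (𝓝 (f x)) → Tendsto u atTop (𝓝 x)) : |f x| = 1 := by
  have hle : |f x| ≤ 1 := by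
    have := f.le_opNorm x
    rwa [hf, hx, one_mul, Real.norm_eq_abs] at this
  refine le_antisymm hle ?_
  by_contra! hlt
  obtain ⟨v, hv1, hv⟩ : ∃ v : X, ‖v‖ = 1 ∧ |f x| < |f v| := by
    by_contra! hcon
    have := ContinuousLinearMap.opNorm_le_of_unit_norm (f := f) (abs_nonneg (f x)) hcon
    linarith
  have hv0 : 0 < |f v| := (abs_nonneg _).trans_lt hv
  have hn : ‖(f x / f v) • v‖ < 1 := by
    rw [norm_smul, hv1, mul_one, Real.norm_eq_abs, abs_div, div_lt_one hv0]
    exact hv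
  have hlim := h (fun _ => (f x / f v) • v) (fun _ => mem_closedBall_zero_iff.2 hn.le) (by
    rw [map_smul, smul_eq_mul, div_mul_cancel₀ _ (abs_pos.1 hv0)]
    exact tendsto_const_nhds)
  have := tendsto_nhds_unique hlim tendsto_const_nhds
  rw [this] at hx
  linarith

theorem exists_differentiableAt_of_isStronglyExposedPoint {μ : LipFree o}
    (h : IsStronglyExposedPoint μ) :
    ∃ f : LipZero o, DifferentiableAt ℝ (fun g : LipZero o => ‖g‖) f := by
  obtain ⟨hμ, ψ, hψ, hexp⟩ := h
  have habs := abs_apply_eq_one_of_stronglyExposing hμ hψ hexp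
  obtain ⟨f, rfl⟩ := (lipZeroDuality o).surjective ψ
  rw [LinearIsometryEquiv.norm_map] at hψ
  simp only [lipZeroDuality_apply] at hexp habs
  -- the sign for which `μ` norms `s • f`
  set s : ℝ := μ.1 f with hs
  have hss : s * s = 1 := by rw [← abs_mul_abs_self, habs, one_mul]
  refine ⟨s • f, μ.1, hasFDerivAt_norm_of_molecule ?_ hμ.le ?_ ?_⟩
  · rw [norm_smul, Real.norm_eq_abs, habs, hψ, one_mul]
  · rw [map_smul, smul_eq_mul, ← hs, hss]
  · by_contra! hcon
    obtain ⟨η, hη, hcon⟩ := hcon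
    choose x y hxy hm hfar using fun n : ℕ =>
      hcon (1 / ((n : ℝ) + 1)) (by positivity)
    have hlim1 : Tendsto (fun n => molecule o (x n) (y n) (s • f)) atTop (𝓝 1) := by
      have h1 : Tendsto (fun n : ℕ => 1 - 1 / ((n : ℝ) + 1)) atTop (𝓝 (1 - 0)) :=
        tendsto_const_nhds.sub tendsto_one_div_add_atTop_nhds_zero_nat
      rw [sub_zero] at h1
      refine tendsto_of_tendsto_of_tendsto_of_le_of_le h1 tendsto_const_nhds
        (fun n => (hm n).le) fun n => ?_
      refine (le_abs_self _).trans ((abs_molecule_le _ _ _).trans ?_)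
      rw [norm_smul, Real.norm_eq_abs, habs, hψ, one_mul]
    have hlim2 := hexp (fun n => ⟨molecule o (x n) (y n), molecule_mem_lipFree _ _⟩)
      (fun n => mem_closedBall_zero_iff.2 (norm_molecule_le _ _)) (by
        have h2 := hlim1.const_mul s
        simp only [map_smul, smul_eq_mul, ← mul_assoc, hss, one_mul, mul_one] at h2
        exact h2)
    obtain ⟨N, hN⟩ := Metric.tendsto_atTop.1 hlim2 η hη
    have h3 : dist (molecule o (x N) (y N)) μ.1 < η := hN N le_rfl
    rw [dist_eq_norm] at h3
    exact (hfar N).not_gt h3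

end FreeSpaceSmulian

/-! ### A point of Fréchet differentiability in spaces that are not metrically convex -/

section PeakFunction

variable {M : Type*} [MetricSpace M] {o : M}

/-- The function `z ↦ (D / 2) (d(z, y) - d(z, x)) / (d(z, y) + d(z, x))` with `D = d(x, y)`. Its
slopes are at most `1`, and they are close to `1` only near the metric segment `[x, y]`. -/
noncomputable def segmentFunction (x y z : M) : ℝ :=
  dist x y / 2 * ((dist z y - dist z x) / (dist z y + dist z x))

theorem segmentFunction_sub_mul_le {x y : M} (hxy : x ≠ y) (u v : M) :
    (segmentFunction x y u - segmentFunction x y v) * (dist u x + dist u y) ≤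
        dist x y * dist u v ∧
      (segmentFunction x y u - segmentFunction x y v) * (dist v x + dist v y) ≤
        dist x y * dist u v := by
  have hD : 0 < dist x y := dist_pos.2 hxy
  have hu : 0 < dist u y + dist u x := by
    have := dist_triangle_left x y u
    linarith
  have hv : 0 < dist v y + dist v x := by
    have := dist_triangle_left x y v
    linarith
  have key : segmentFunction x y u - segmentFunction x y v =
      dist x y * (dist u y * dist v x - dist u x * dist v y) /
        ((dist u y + dist u x) * (dist v y + dist v x)) := by
    unfold segmentFunction
    field_simp
    ring
  have h1 : dist v x - dist u x ≤ dist u v := by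
    have := dist_triangle_left v x u
    linarith
  have h2 : dist u y - dist v y ≤ dist u v := by
    have := dist_triangle u v y
    linarith
  rw [key]
  constructor
  · rw [div_mul_eq_mul_div, div_le_iff₀ (by positivity)]
    have h3 : dist u y * dist v x - dist u x * dist v y ≤
        dist u v * (dist v y + dist v x) := by
      nlinarith [mul_le_mul_of_nonneg_left h1 (dist_nonneg (x := v) (y := y)),
        mul_le_mul_of_nonneg_left h2 (dist_nonneg (x := v) (y := x))]
    calc dist x y * (dist u y * dist v x - dist u x * dist v y) * (dist u x + dist u y)
        ≤ dist x y * (dist u v * (dist v y + dist v x)) * (dist u x + dist u y) := by gcongr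
      _ = _ := by ring
  · rw [div_mul_eq_mul_div, div_le_iff₀ (by positivity)]
    have h3 : dist u y * dist v x - dist u x * dist v y ≤
        dist u v * (dist u y + dist u x) := by
      nlinarith [mul_le_mul_of_nonneg_left h1 (dist_nonneg (x := u) (y := y)),
        mul_le_mul_of_nonneg_left h2 (dist_nonneg (x := u) (y := x))]
    calc dist x y * (dist u y * dist v x - dist u x * dist v y) * (dist v x + dist v y)
        ≤ dist x y * (dist u v * (dist u y + dist u x)) * (dist v x + dist v y) := by gcongr
      _ = _ := by ring

theorem lipschitzWith_segmentFunction {x y : M} (hxy : x ≠ y) :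
    LipschitzWith 1 (segmentFunction x y) := by
  refine LipschitzWith.of_le_add fun u v => ?_
  by_contra! hlt
  have h := (segmentFunction_sub_mul_le hxy u v).1
  have h1 := dist_triangle_left x y u
  have hD : 0 < dist x y := dist_pos.2 hxy
  have h2 : dist u v * dist x y < (segmentFunction x y u - segmentFunction x y v) *
      (dist u x + dist u y) :=
    mul_lt_mul (by linarith) h1 hD (by linarith [dist_nonneg (x := u) (y := v)])
  linarith

/-- If the metric segment `[x, y]` is trivial in the quantitative sense of the hypothesis `hgap`,
then there is a function of slope at most `1` that descends from `x` to `y` with slope `1` and has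
slopes bounded away from `1` on pairs that are both close to `x` or both close to `y`. It is an
extension of `D / 2 - (1 - ε / 2) d(·, x)` near `x` and `-D / 2 + (1 - ε / 2) d(·, y)` near `y`. -/
theorem exists_lipschitzWith_flat_at_ends {x y : M} (hxy : x ≠ y) {ε : ℝ} (hε : 0 < ε)
    (hε1 : ε < 1)
    (hgap : ∀ z, dist x y + ε * min (dist x z) (dist z y) ≤ dist x z + dist z y) :
    ∃ g : M → ℝ, LipschitzWith 1 g ∧
      (∀ z, dist z x ≤ dist x y / 4 → g z = dist x y / 2 - (1 - ε / 2) * dist z x) ∧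
      (∀ z, dist z y ≤ dist x y / 4 → g z = -(dist x y / 2) + (1 - ε / 2) * dist z y) := by
  classical
  set D := dist x y with hD
  have hDpos : 0 < D := dist_pos.2 hxy
  let g₀ : M → ℝ := fun z =>
    if dist z x ≤ D / 4 then D / 2 - (1 - ε / 2) * dist z x
    else -(D / 2) + (1 - ε / 2) * dist z y
  have hx : ∀ z, dist z x ≤ D / 4 → g₀ z = D / 2 - (1 - ε / 2) * dist z x := fun z hz =>
    if_pos hz
  have hy : ∀ z, dist z y ≤ D / 4 → g₀ z = -(D / 2) + (1 - ε / 2) * dist z y := fun z hz => by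
    refine if_neg fun hz' => ?_
    have := dist_triangle_left x y z
    linarith
  have hcross : ∀ u v, dist u x ≤ D / 4 → dist v y ≤ D / 4 →
      |g₀ u - g₀ v| ≤ dist u v := by
    intro u v hu hv
    rw [hx u hu, hy v hv]
    have hgu := hgap u
    have hgv := hgap v
    have t1 := dist_triangle x u y
    have t2 := dist_triangle x v y
    rw [dist_comm x u] at hgu t1
    rw [min_eq_left (by linarith)] at hgu
    rw [min_eq_right (by linarith)] at hgv
    have t3 := dist_triangle u v y
    have t4 := dist_triangle_left x v u
    have h1 : 0 ≤ ε * dist u x := by positivity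
    have h2 : 0 ≤ ε * dist v y := by positivity
    rw [abs_le]
    constructor <;> linarith
  have hlip : LipschitzOnWith 1 g₀ {z | dist z x ≤ D / 4 ∨ dist z y ≤ D / 4} := by
    refine LipschitzOnWith.of_dist_le_mul fun u hu v hv => ?_
    rw [Real.dist_eq, NNReal.coe_one, one_mul]
    have hsame : ∀ z, |(1 - ε / 2) * (dist v z - dist u z)| ≤ dist u v := fun z => by
      rw [abs_mul, abs_of_pos (by linarith : 0 < 1 - ε / 2)]
      have h1 := abs_dist_sub_le v u z
      rw [dist_comm v u] at h1
      exact (mul_le_of_le_one_left (abs_nonneg _) (by linarith)).trans h1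
    rcases hu with hu | hu <;> rcases hv with hv | hv
    · rw [hx u hu, hx v hv]
      convert hsame x using 2
      ring
    · exact hcross u v hu hv
    · rw [abs_sub_comm, dist_comm]
      exact hcross v u hv hu
    · rw [hy u hu, hy v hv, ← abs_neg]
      convert hsame y using 2
      ring
  obtain ⟨g, hg, hgg⟩ := hlip.extend_real
  exact ⟨g, hg, fun z hz => by rw [← hgg (Or.inl hz), hx z hz],
    fun z hz => by rw [← hgg (Or.inr hz), hy z hz]⟩

/-- The average of the two functions above has slope `1` between `x` and `y`, and its slope is close
to `1` only for pairs close to `(x, y)`. -/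
theorem exists_differentiableAt_norm_of_gap (o : M) {x y : M} (hxy : x ≠ y) {ε : ℝ} (hε : 0 < ε)
    (hε1 : ε < 1)
    (hgap : ∀ z, dist x y + ε * min (dist x z) (dist z y) ≤ dist x z + dist z y) :
    ∃ f : LipZero o, DifferentiableAt ℝ (fun g : LipZero o => ‖g‖) f := by
  obtain ⟨g, hg, hgx, hgy⟩ := exists_lipschitzWith_flat_at_ends hxy hε hε1 hgap
  set D := dist x y with hDdef
  have hD : 0 < D := dist_pos.2 hxy
  let s := segmentFunction x y
  have hs : LipschitzWith 1 s := lipschitzWith_segmentFunction hxy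
  have hsx : s x = D / 2 := by
    simp only [s, segmentFunction, dist_self, sub_zero, add_zero, ← hDdef]
    field_simp
  have hsy : s y = -(D / 2) := by
    simp only [s, segmentFunction, dist_self, zero_sub, zero_add, dist_comm y x, ← hDdef]
    field_simp
  have hgx' : g x = D / 2 := by
    have := hgx x (by rw [dist_self]; linarith)
    rwa [dist_self, mul_zero, sub_zero] at this
  have hgy' : g y = -(D / 2) := by
    have := hgy y (by rw [dist_self]; linarith)
    rwa [dist_self, mul_zero, add_zero] at this
  have hG : ∀ u v, g u - g v ≤ dist u v := fun u v => by
    have := (le_abs_self _).trans (hg.dist_le_mul u v)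
    rwa [NNReal.coe_one, one_mul] at this
  have hS : ∀ u v, s u - s v ≤ dist u v := fun u v => by
    have := (le_abs_self _).trans (hs.dist_le_mul u v)
    rwa [NNReal.coe_one, one_mul] at this
  have hlip : LipschitzWith 1 fun z => (g z + s z) / 2 := by
    refine LipschitzWith.of_le_add fun u v => ?_
    linarith [hG u v, hS u v]
  set f := LipZero.ofLipschitz o hlip with hfdef
  have hfsub : ∀ u v, f u - f v = ((g u - g v) + (s u - s v)) / 2 := fun u v => by
    rw [hfdef, LipZero.ofLipschitz_apply, LipZero.ofLipschitz_apply]; ring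
  have hfxy : molecule o x y f = 1 := by
    rw [molecule_apply, hfsub, hgx', hgy', hsx, hsy, ← hDdef]
    field_simp
    ring
  have hf : ‖f‖ = 1 := by
    refine le_antisymm (by simpa using LipZero.norm_ofLipschitz_le hlip) ?_
    rw [← hfxy]
    exact (le_abs_self _).trans (abs_molecule_le x y f)
  refine ⟨f, molecule o x y, hasFDerivAt_norm_of_molecule hf (norm_molecule_le x y) hfxy
    fun η hη => ?_⟩
  obtain ⟨ρ', hρ', hclose⟩ := Metric.continuousAt_iff.1 (continuousAt_molecule (o := o) hxy) η hη
  set ρ := min ρ' (D / 4) with hρdef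
  have hρ : 0 < ρ := by positivity
  refine ⟨min (ε / 4) (ρ * ε / (4 * D)), by positivity, fun u v huv hm => ?_⟩
  set δ := min (ε / 4) (ρ * ε / (4 * D)) with hδdef
  have hδ : 0 < δ := by positivity
  have hδε : δ ≤ ε / 4 := min_le_left _ _
  have hδρ : 4 * δ * D ≤ ρ * ε := by
    calc 4 * δ * D ≤ 4 * (ρ * ε / (4 * D)) * D := by gcongr; exact min_le_right _ _
      _ = ρ * ε := by field_simp
  have hduv : 0 < dist u v := dist_pos.2 huv
  rw [molecule_apply, lt_div_iff₀ hduv, hfsub] at hm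
  have hm1 : (1 - 2 * δ) * dist u v < s u - s v := by linarith [hG u v]
  have hm2 : (1 - 2 * δ) * dist u v < g u - g v := by linarith [hS u v]
  -- both points of the pair are close to an end point
  have hnear : ∀ z, (s u - s v) * (dist z x + dist z y) ≤ D * dist u v →
      dist z x < ρ ∨ dist z y < ρ := by
    intro z hz
    have h1 : (1 - 2 * δ) * (dist z x + dist z y) ≤ D := by
      have h2 : (1 - 2 * δ) * dist u v * (dist z x + dist z y) ≤ D * dist u v :=
        (mul_le_mul_of_nonneg_right hm1.le (by positivity)).trans hz
      have h3 : (1 - 2 * δ) * (dist z x + dist z y) * dist u v ≤ D * dist u v := by linarith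
      exact le_of_mul_le_mul_right h3 hduv
    have h4 := hgap z
    rw [dist_comm x z] at h4
    rw [← min_lt_iff]
    set m := min (dist z x) (dist z y) with hmdef
    have hm0 : 0 ≤ m := le_min dist_nonneg dist_nonneg
    have h5 : (1 - 2 * δ) * (D + ε * m) ≤ D :=
      (mul_le_mul_of_nonneg_left h4 (by linarith)).trans h1
    have h6 : (1 / 2) * (ε * m) ≤ (1 - 2 * δ) * (ε * m) := by gcongr; linarith
    have h7 : ε * m < ε * (ρ * 2) := by nlinarith
    have h8 : ε * m ≤ ε * ρ := by nlinarith
    by_contra! hle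
    have h9 : ε * m = ε * ρ := le_antisymm h8 (by gcongr)
    nlinarith
  have hρD : ρ ≤ D / 4 := min_le_right _ _
  have hflat : ∀ z, (1 - ε / 2) * (dist v z - dist u z) ≤ (1 - 2 * δ) * dist u v := fun z => by
    have h1 : dist v z - dist u z ≤ dist u v := by linarith [dist_triangle_left v z u]
    calc (1 - ε / 2) * (dist v z - dist u z) ≤ (1 - ε / 2) * dist u v := by
          apply mul_le_mul_of_nonneg_left h1; linarith
      _ ≤ (1 - 2 * δ) * dist u v := by gcongr; linarith
  rcases hnear u (segmentFunction_sub_mul_le hxy u v).1 with hu | hu <;>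
    rcases hnear v (segmentFunction_sub_mul_le hxy u v).2 with hv | hv
  · rw [hgx u (by linarith), hgx v (by linarith)] at hm2
    linarith [hflat x]
  · have hd : dist (u, v) (x, y) < ρ' := by
      rw [Prod.dist_eq, max_lt_iff]
      exact ⟨hu.trans_le (min_le_left _ _), hv.trans_le (min_le_left _ _)⟩
    have := hclose hd
    rw [dist_eq_norm] at this
    exact this.le
  · exfalso
    rw [hgy u (by linarith), hgx v (by linarith)] at hm2
    have h1 : (1 - ε / 2) * dist u y ≤ 1 * (D / 4) := by gcongr <;> linarith
    have h2 : (1 - ε / 2) * dist v x ≤ 1 * (D / 4) := by gcongr <;> linarith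
    have h3 : 0 ≤ (1 - 2 * δ) * dist u v := mul_nonneg (by linarith) hduv.le
    linarith
  · rw [hgy u (by linarith), hgy v (by linarith)] at hm2
    have h1 : (1 - ε / 2) * (dist u y - dist v y) ≤ (1 - 2 * δ) * dist u v := by
      have h1 : dist u y - dist v y ≤ dist u v := by linarith [dist_triangle u v y]
      calc (1 - ε / 2) * (dist u y - dist v y) ≤ (1 - ε / 2) * dist u v := by
            apply mul_le_mul_of_nonneg_left h1; linarith
        _ ≤ (1 - 2 * δ) * dist u v := by gcongr; linarith
    linarith

end PeakFunction

/-! ### Steep points in metrically convex spaces -/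

section SteepPoints

variable {M : Type*} [MetricSpace M] {o : M}

/-- The points from which `f` descends with slope more than `c` at arbitrarily small scales. -/
def steepPoints (f : M → ℝ) (c : ℝ) : Set M :=
  {p | ∀ δ > 0, ∃ q, p ≠ q ∧ dist p q < δ ∧ c * dist p q < f p - f q}

/-- Along a geodesic `σ` with average slope more than `c`, the function `ψ(t) = f(σ t) + c t` takes
a smaller value at the end than at the beginning. For each of the uncountably many levels in
between, the last time at which `ψ` has that level gives a steep point. -/
theorem infinite_steepPoints [CompactSpace M] (hM : IsMetricallyConvex M) {f : LipZero o} {c : ℝ}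
    (hc0 : 0 ≤ c) (hc : c < ‖f‖) : (steepPoints f c).Infinite := by
  obtain ⟨x, y, hxy, hm⟩ := exists_lt_molecule hc0 hc
  set D := dist x y with hDdef
  have hD : 0 < D := dist_pos.2 hxy
  rw [molecule_apply, lt_div_iff₀ hD] at hm
  obtain ⟨σ, hσ0, hσD, hσ⟩ := hM.exists_isometric_segment x y
  rw [← hDdef] at hσ hσD
  let ψ : ℝ → ℝ := fun t => f (σ t) + c * t
  have hσc : ContinuousOn σ (Set.Icc 0 D) := by
    refine (LipschitzOnWith.of_dist_le_mul (K := 1) fun s hs t ht => ?_).continuousOn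
    rw [hσ s hs t ht, Real.dist_eq, NNReal.coe_one, one_mul]
  have hψ : ContinuousOn ψ (Set.Icc 0 D) :=
    (f.lipschitzWith.continuous.comp_continuousOn hσc).add (by fun_prop)
  have hends : ψ D < ψ 0 := by
    simp only [ψ, hσ0, hσD]; linarith
  have hlast : ∀ l ∈ Set.Ioo (ψ D) (ψ 0), ∃ t ∈ Set.Ico 0 D, ψ t = l ∧
      ∀ s ∈ Set.Ioc t D, ψ s < l := by
    intro l hl
    have hS : IsCompact {t ∈ Set.Icc 0 D | l ≤ ψ t} :=
      isCompact_Icc.of_isClosed_subset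
        (hψ.preimage_isClosed_of_isClosed isClosed_Icc (isClosed_Ici (a := l))) fun t ht => ht.1
    obtain ⟨t, ⟨htI, htl⟩, hmax⟩ := hS.exists_isGreatest ⟨0, ⟨le_rfl, hD.le⟩, hl.2.le⟩
    have hlater : ∀ s ∈ Set.Ioc t D, ψ s < l := fun s hs => by
      by_contra! hle
      have := hmax ⟨⟨htI.1.trans hs.1.le, hs.2⟩, hle⟩
      exact absurd hs.1 (not_lt.2 this)
    have htD : t ≠ D := by
      rintro rfl
      exact absurd hl.1 (not_lt.2 htl)
    refine ⟨t, ⟨htI.1, lt_of_le_of_ne htI.2 htD⟩, ?_, hlater⟩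
    obtain ⟨s, hs, hsl⟩ := intermediate_value_Icc' htI.2
      (hψ.mono (Set.Icc_subset_Icc_left htI.1)) (show l ∈ Set.Icc (ψ D) (ψ t) from ⟨hl.1.le, htl⟩)
    rcases eq_or_lt_of_le hs.1 with rfl | hlt
    · exact hsl
    · exact absurd hsl (hlater s ⟨hlt, hs.2⟩).ne
  choose! τ hτI hτψ hτ using hlast
  have hτI' : ∀ l ∈ Set.Ioo (ψ D) (ψ 0), τ l ∈ Set.Icc 0 D := fun l hl =>
    Set.Ico_subset_Icc_self (hτI l hl)
  refine Set.infinite_of_injOn_mapsTo (f := fun l => σ (τ l)) (s := Set.Ioo (ψ D) (ψ 0)) ?_ ?_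
    (Set.Ioo_infinite hends)
  · intro l hl l' hl' heq
    have h1 := hσ _ (hτI' l hl) _ (hτI' l' hl')
    simp only at heq
    rw [heq, dist_self] at h1
    have h2 : τ l = τ l' := sub_eq_zero.1 (abs_eq_zero.1 h1.symm)
    rw [← hτψ l hl, ← hτψ l' hl', h2]
  · intro l hl δ hδ
    set t := τ l with htdef
    have htD : t < D := (hτI l hl).2
    set s := min D (t + δ / 2) with hsdef
    have hts : t < s := lt_min htD (by linarith)
    have hsI : s ∈ Set.Icc 0 D := ⟨(hτI l hl).1.trans hts.le, min_le_left _ _⟩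
    have hd : dist (σ t) (σ s) = s - t := by
      rw [hσ t (hτI' l hl) s hsI, abs_sub_comm, abs_of_pos (by linarith)]
    refine ⟨σ s, dist_pos.1 (by rw [hd]; linarith), ?_, ?_⟩
    · rw [hd]
      have : s ≤ t + δ / 2 := min_le_right _ _
      linarith
    · have h1 := hτ l hl s ⟨hts, hsI.2⟩
      have h2 := hτψ l hl
      simp only [ψ, ← htdef] at h1 h2
      change c * dist (σ t) (σ s) < f (σ t) - f (σ s)
      rw [hd]
      linarith

end SteepPoints

/-! ### Failure of Gâteaux differentiability -/

section Gateaux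

/-- A supporting functional determines the directional derivative of the norm. -/
theorem HasLineDerivAt.eq_of_norming {X : Type*} [NormedAddCommGroup X] [NormedSpace ℝ X]
    {f h : X} {L a : ℝ} (hL : HasLineDerivAt ℝ (fun g : X => ‖g‖) L f h)
    (ha : ∀ ε > 0, ∃ ψ : StrongDual ℝ X, ‖ψ‖ ≤ 1 ∧ ‖f‖ - ε < ψ f ∧ ψ h = a) : L = a := by
  have hle : ∀ t : ℝ, ‖f‖ + t * a ≤ ‖f + t • h‖ := fun t => le_of_forall_pos_lt_add fun ε hε => by
    obtain ⟨ψ, hψ, hψf, hψh⟩ := ha ε hε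
    have := (le_abs_self _).trans (ψ.le_of_opNorm_le hψ (f + t • h))
    rw [map_add, map_smul, smul_eq_mul, hψh, one_mul] at this
    linarith
  have hL' : HasDerivAt (fun t : ℝ => ‖f + t • h‖) L 0 := hL
  have hder : HasDerivAt (fun t : ℝ => ‖f + t • h‖ - t * a) (L - 1 * a) 0 :=
    hL'.sub ((hasDerivAt_id 0).mul_const a)
  have hmin : IsLocalMin (fun t : ℝ => ‖f + t • h‖ - t * a) 0 :=
    Filter.Eventually.of_forall fun t => by
      have := hle t
      simp only [zero_smul, add_zero, zero_mul, sub_zero]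
      linarith
  have := hmin.hasDerivAt_eq_zero hder
  linarith

variable {M : Type*} [MetricSpace M] {o : M}

/-- Pairs of points `(p n, q n)` with slope tending to `‖f‖`, such that the open ball of radius
`d(p n, q n)` about `p n` contains no point of another pair. The points `p n` are distinct steep
points that converge to a further point. -/
theorem exists_separated_steep_pairs [CompactSpace M] (hM : IsMetricallyConvex M) {f : LipZero o}
    (hf : f ≠ 0) :
    ∃ p q : ℕ → M, (∀ n, p n ≠ q n) ∧
      (∀ n k, n ≠ k → dist (p n) (q n) ≤ dist (p k) (p n) ∧ dist (p n) (q n) ≤ dist (q k) (p n)) ∧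
      ∀ ε > 0, ∀ᶠ n in atTop, ‖f‖ - ε < molecule o (p n) (q n) f := by
  have hfn : 0 < ‖f‖ := norm_pos_iff.2 hf
  let c : ℕ → ℝ := fun n => ‖f‖ - ‖f‖ / (n + 1)
  have hc0 : ∀ n, 0 ≤ c n := fun n => by
    have : ‖f‖ / ((n : ℝ) + 1) ≤ ‖f‖ := div_le_self hfn.le (by linarith [n.cast_nonneg (α := ℝ)])
    simp only [c]; linarith
  have hclt : ∀ n, c n < ‖f‖ := fun n => by
    have : 0 < ‖f‖ / ((n : ℝ) + 1) := by positivity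
    simp only [c]; linarith
  have hclim : Tendsto c atTop (𝓝 ‖f‖) := by
    have h := (tendsto_one_div_add_atTop_nhds_zero_nat (𝕜 := ℝ)).const_mul ‖f‖
    have h2 := (tendsto_const_nhds (x := ‖f‖)).sub h
    simpa [c, div_eq_mul_inv] using h2
  -- distinct points that are steeper and steeper
  obtain ⟨P, hP, hPr⟩ := exists_seq_of_forall_finset_exists
    (fun a : ℕ × M => a.2 ∈ steepPoints f (c a.1)) (fun a b => a.1 < b.1 ∧ a.2 ≠ b.2) (by
      classical
      intro s _
      obtain ⟨p, hp, hps⟩ := (infinite_steepPoints hM (hc0 (s.sup Prod.fst + 1))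
        (hclt _)).exists_notMem_finset (s.image Prod.snd)
      refine ⟨(s.sup Prod.fst + 1, p), hp, fun a ha => ⟨?_, fun h => hps ?_⟩⟩
      · exact Nat.lt_succ_of_le (Finset.le_sup (f := Prod.fst) ha)
      · exact Finset.mem_image.2 ⟨a, ha, h⟩)
  obtain ⟨b, -, φ, hφ, hlim⟩ := isCompact_univ.tendsto_subseq (x := fun n => (P n).2)
    fun n => Set.mem_univ _
  have hinj : Function.Injective fun n => (P (φ n)).2 := by
    intro n m hnm
    by_contra hne
    rcases lt_or_gt_of_ne hne with h | h
    · exact (hPr _ _ (hφ h)).2 hnm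
    · exact (hPr _ _ (hφ h)).2 hnm.symm
  obtain ⟨N, hN⟩ : ∃ N, ∀ n ≥ N, (P (φ n)).2 ≠ b := by
    by_cases h : ∃ m, (P (φ m)).2 = b
    · obtain ⟨m, rfl⟩ := h
      exact ⟨m + 1, fun n hn hnm => by have := hinj hnm; omega⟩
    · push Not at h
      exact ⟨0, fun n _ => h n⟩
  set p : ℕ → M := fun n => (P (φ (n + N))).2 with hpdef
  set i : ℕ → ℕ := fun n => (P (φ (n + N))).1 with hidef
  have hpb : ∀ n, p n ≠ b := fun n => hN _ (Nat.le_add_left N n)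
  have hpinj : Function.Injective p := fun n m h => Nat.add_right_cancel (hinj h)
  have hplim : Tendsto p atTop (𝓝 b) := hlim.comp (tendsto_add_atTop_nat N)
  have hmono : StrictMono i := fun n m h => (hPr _ _ (hφ (Nat.add_lt_add_right h N))).1
  -- the points are isolated from each other
  have hsep : ∀ n, ∃ s > 0, ∀ k, k ≠ n → s ≤ dist (p k) (p n) := by
    intro n
    have hr : 0 < dist (p n) b := dist_pos.2 (hpb n)
    obtain ⟨K, hK⟩ := Metric.tendsto_atTop.1 hplim (dist (p n) b / 2) (by linarith)
    have hfin : ∀ᶠ s in 𝓝[>] (0 : ℝ), ∀ k ∈ Finset.range K, k ≠ n → s ≤ dist (p k) (p n) := by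
      rw [Filter.eventually_all_finset]
      intro k _
      rcases eq_or_ne k n with rfl | hk
      · simp
      · have : 0 < dist (p k) (p n) := dist_pos.2 fun h => hk (hpinj h)
        filter_upwards [nhdsWithin_le_nhds (Iio_mem_nhds this)] with s hs _
        exact le_of_lt hs
    have hsmall : ∀ᶠ s in 𝓝[>] (0 : ℝ), s < dist (p n) b / 2 :=
      nhdsWithin_le_nhds (Iio_mem_nhds (by linarith))
    obtain ⟨s, ⟨hs1, hs2⟩, hs3⟩ := ((hfin.and hsmall).and self_mem_nhdsWithin).exists
    refine ⟨s, hs3, fun k hk => ?_⟩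
    rcases lt_or_ge k K with h | h
    · exact hs1 k (Finset.mem_range.2 h) hk
    · have h1 := hK k h
      have h2 := dist_triangle_left (p n) b (p k)
      linarith
  choose s hs0 hs using hsep
  choose q hpq hqd hq using fun n => hP (φ (n + N)) (s n / 4) (by linarith [hs0 n])
  have hqd' : ∀ n, dist (p n) (q n) < s n / 4 := hqd
  refine ⟨p, q, hpq, fun n k hnk => ?_, fun ε hε => ?_⟩
  · have h1 := hs n k hnk.symm
    have h2 := hs k n hnk
    have h3 := hqd' n
    have h4 := hqd' k
    have h5 := dist_triangle (p k) (q k) (p n)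
    rw [dist_comm (p n) (p k)] at h2
    have h6 := hs0 n
    constructor <;> linarith
  · have h1 := (hclim.comp hmono.tendsto_atTop).eventually
      (lt_mem_nhds (show ‖f‖ - ε < ‖f‖ by linarith))
    filter_upwards [h1] with n hn
    refine lt_trans hn ?_
    rw [molecule_apply, lt_div_iff₀ (dist_pos.2 (hpq n))]
    exact hq n

/-- The direction in which the norm is not differentiable at `f` is the distance to the complement
of a union of small balls; it has slope `1` on every other one of a sequence of separated pairs on
which `f` is steeper and steeper, and slope `0` on the rest. -/
theorem IsMetricallyConvex.not_gateauxDifferentiableAt_norm [CompactSpace M] [Nontrivial M]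
    (hM : IsMetricallyConvex M) (f : LipZero o) :
    ¬ GateauxDifferentiableAt (fun g : LipZero o => ‖g‖) f := by
  rintro ⟨φ, hφ⟩
  rcases eq_or_ne f 0 with rfl | hf
  · have : Nontrivial (LipZero o) := lipZero_nontrivial
    obtain ⟨h, hh⟩ := exists_ne (0 : LipZero o)
    obtain ⟨ψ, hψ, hψh⟩ := exists_dual_vector ℝ h (norm_ne_zero_iff.2 hh)
    have h1 := (hφ h).eq_of_norming (a := ‖h‖) fun ε hε =>
      ⟨ψ, hψ.le, by simpa using hε, hψh⟩
    have h2 := (hφ h).eq_of_norming (a := -‖h‖) fun ε hε =>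
      ⟨-ψ, by rw [norm_neg, hψ], by simpa using hε, by rw [neg_apply, hψh]; rfl⟩
    have := norm_pos_iff.2 hh
    linarith
  · obtain ⟨p, q, hpq, hsep, hsteep⟩ := exists_separated_steep_pairs hM hf
    let U : Set M := {z | ∀ n, dist (p (2 * n)) (q (2 * n)) ≤ dist z (p (2 * n))}
    have hqU : ∀ k, q k ∈ U := fun k n => by
      rcases eq_or_ne (2 * n) k with rfl | hne
      · rw [dist_comm]
      · exact (hsep _ _ hne).2
    have hpU : ∀ k, p (2 * k + 1) ∈ U := fun k n => (hsep (2 * n) (2 * k + 1) (by omega)).1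
    have hUne : U.Nonempty := ⟨q 0, hqU 0⟩
    set h := LipZero.ofLipschitz o (Metric.lipschitz_infDist_pt U) with hh
    have hmol : ∀ n, molecule o (p n) (q n) h =
        Metric.infDist (p n) U / dist (p n) (q n) := fun n => by
      rw [molecule_apply, hh, LipZero.ofLipschitz_apply, LipZero.ofLipschitz_apply,
        sub_sub_sub_cancel_right, Metric.infDist_zero_of_mem (hqU n), sub_zero]
    have heven : ∀ n, molecule o (p (2 * n)) (q (2 * n)) h = 1 := fun n => by
      rw [hmol, div_eq_one_iff_eq (dist_pos.2 (hpq _)).ne']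
      refine le_antisymm (Metric.infDist_le_dist_of_mem (hqU _)) ?_
      refine (Metric.le_infDist hUne).2 fun z hz => ?_
      rw [dist_comm _ z]
      exact hz n
    have hodd : ∀ n, molecule o (p (2 * n + 1)) (q (2 * n + 1)) h = 0 := fun n => by
      rw [hmol, Metric.infDist_zero_of_mem (hpU n), zero_div]
    have h1 := (hφ h).eq_of_norming (a := 1) fun ε hε => by
      obtain ⟨n, hn⟩ := eventually_atTop.1 (hsteep ε hε)
      exact ⟨_, norm_molecule_le _ _, hn (2 * n) (by omega), heven n⟩
    have h2 := (hφ h).eq_of_norming (a := 0) fun ε hε => by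
      obtain ⟨n, hn⟩ := eventually_atTop.1 (hsteep ε hε)
      exact ⟨_, norm_molecule_le _ _, hn (2 * n + 1) (by omega), hodd n⟩
    linarith

end Gateaux

/-! ### The Daugavet property -/

section Daugavet

variable {M : Type*} [MetricSpace M] {o : M}

/-- A function of slope at most `1` can be changed within a ball of radius `R` about `p` so that it
descends with slope `1` from `p` to a given point `q` very close to `p`, while its slopes remain at
most `1 + ε`. -/
theorem exists_steep_modification (f : LipZero o) (hf : ‖f‖ ≤ 1) {ε R : ℝ} (hε : 0 < ε)
    (hε1 : ε ≤ 1) (hR : 0 < R) {p q : M} (hpq : dist p q < ε * R / 3) :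
    ∃ g : M → ℝ, LipschitzWith (1 + ε).toNNReal g ∧ (∀ z, R ≤ dist z p → g z = f z) ∧
      g p - g q = dist p q := by
  classical
  have hf1 : ∀ u v, |f u - f v| ≤ dist u v := fun u v =>
    (f.abs_sub_le u v).trans (mul_le_of_le_one_left dist_nonneg hf)
  have hdR : dist p q < R := by nlinarith
  have hcoe : ((1 + ε).toNNReal : ℝ) = 1 + ε := Real.coe_toNNReal _ (by linarith)
  let g₀ : M → ℝ := fun z => if z = q then f p - dist p q else f z
  have hq : g₀ q = f p - dist p q := if_pos rfl
  have hne : ∀ z, z ≠ q → g₀ z = f z := fun z hz => if_neg hz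
  have hp : g₀ p = f p := by
    rcases eq_or_ne p q with rfl | h
    · rw [hq, dist_self, sub_zero]
    · exact hne p h
  have hqA : ∀ z, R ≤ dist z p → z ≠ q := by
    rintro z hz rfl
    rw [dist_comm] at hz
    linarith
  have hfar : ∀ z, R ≤ dist z p → |g₀ z - g₀ q| ≤ (1 + ε) * dist z q := fun z hz => by
    rw [hne z (hqA z hz), hq]
    have h1 := abs_le.1 (hf1 z p)
    have h2 := dist_triangle_right z p q
    have h3 := dist_nonneg (x := p) (y := q)
    have h4 : ε * R ≤ ε * dist z p := by gcongr
    have h5 : ε * dist p q ≤ 1 * dist p q := by gcongr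
    have h6 : ε * (dist z p - dist p q) ≤ ε * dist z q := by gcongr; linarith
    rw [abs_le]
    constructor <;> linarith
  have hlip : LipschitzOnWith (1 + ε).toNNReal g₀ {z | R ≤ dist z p ∨ z = p ∨ z = q} := by
    refine LipschitzOnWith.of_dist_le_mul fun u hu v hv => ?_
    rw [Real.dist_eq, hcoe]
    have hmono : ∀ u v : M, dist u v ≤ (1 + ε) * dist u v := fun u v =>
      le_mul_of_one_le_left dist_nonneg (by linarith)
    have hoff : ∀ u v : M, u ≠ q → v ≠ q → |g₀ u - g₀ v| ≤ (1 + ε) * dist u v := fun u v hu hv => by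
      rw [hne u hu, hne v hv]
      exact (hf1 u v).trans (hmono u v)
    have hwq : ∀ w, (R ≤ dist w p ∨ w = p ∨ w = q) → |g₀ w - g₀ q| ≤ (1 + ε) * dist w q := by
      rintro w (hw | rfl | rfl)
      · exact hfar w hw
      · rw [hp, hq, sub_sub_cancel, abs_of_nonneg dist_nonneg]
        exact hmono _ _
      · simp
    by_cases huq : u = q
    · subst huq
      rw [abs_sub_comm, dist_comm]
      exact hwq v hv
    · by_cases hvq : v = q
      · subst hvq
        exact hwq u hu
      · exact hoff u v huq hvq
  obtain ⟨g, hg, hgg⟩ := hlip.extend_real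
  refine ⟨g, hg, fun z hz => ?_, ?_⟩
  · rw [← hgg (Or.inl hz), hne z (hqA z hz)]
  · rw [← hgg (Or.inr (Or.inl rfl)), ← hgg (Or.inr (Or.inr rfl)), hp, hq, sub_sub_cancel]

/-- A sum of functions that vanish outside disjoint balls. Any two points lie in the supports of at
most two of the functions. -/
theorem norm_sum_le_of_disjoint_supports {s : Finset M} {R C : ℝ} (hC : 0 ≤ C)
    (hs : ∀ p ∈ s, ∀ p' ∈ s, p ≠ p' → 2 * R ≤ dist p p') {B : M → LipZero o}
    (hB : ∀ p ∈ s, ‖B p‖ ≤ C)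
    (hsupp : ∀ p ∈ s, ∀ x y, R ≤ dist x p → R ≤ dist y p → B p x = B p y) :
    ‖∑ p ∈ s, B p‖ ≤ 2 * C := by
  classical
  refine LipZero.norm_le_of_forall (by positivity) fun x y => ?_
  have hsum : ∀ z, (∑ p ∈ s, B p) z = ∑ p ∈ s, B p z := fun z =>
    (congrArg (fun ψ => ψ) (map_sum (lipEval o z) B s) :)
  let t : M → Finset M := fun z => s.filter fun p => dist z p < R
  have ht : ∀ z, (t z).card ≤ 1 := fun z => by
    rw [Finset.card_le_one]
    intro p hp p' hp'
    rw [Finset.mem_filter] at hp hp'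
    by_contra hne
    have h1 := hs p hp.1 p' hp'.1 hne
    have h2 := dist_triangle_left p p' z
    linarith
  rw [hsum, hsum, ← Finset.sum_sub_distrib]
  have hsub : ∑ p ∈ t x ∪ t y, (B p x - B p y) = ∑ p ∈ s, (B p x - B p y) := by
    refine Finset.sum_subset
      (Finset.union_subset (Finset.filter_subset _ _) (Finset.filter_subset _ _))
      fun p hp hpt => ?_
    simp only [t, Finset.mem_union, Finset.mem_filter, not_or, not_and, not_lt] at hpt
    rw [hsupp p hp x y (hpt.1 hp) (hpt.2 hp), sub_self]
  rw [← hsub]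
  calc |∑ p ∈ t x ∪ t y, (B p x - B p y)| ≤ ∑ p ∈ t x ∪ t y, |B p x - B p y| :=
        Finset.abs_sum_le_sum_abs _ _
    _ ≤ (t x ∪ t y).card • (C * dist x y) := by
        refine Finset.sum_le_card_nsmul _ _ _ fun p hp => ?_
        have hps : p ∈ s := by
          rcases Finset.mem_union.1 hp with h | h <;> exact (Finset.mem_filter.1 h).1
        exact ((B p).abs_sub_le x y).trans (by gcongr; exact hB p hps)
    _ ≤ 2 * (C * dist x y) := by
        rw [nsmul_eq_mul]
        have h1 : (t x ∪ t y).card ≤ 2 :=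
          (Finset.card_union_le _ _).trans (by linarith [ht x, ht y])
        have h2 : ((t x ∪ t y).card : ℝ) ≤ 2 := by exact_mod_cast h1
        gcongr
    _ = 2 * C * dist x y := by ring

/-- An almost norming function `f₀` for `φ` is modified near many steep points of `g`, one at a
time. As the modifications have disjoint supports, their sum is bounded independently of their
number, so that one of them is almost invisible to `φ`. -/
theorem IsMetricallyConvex.exists_norm_add_smul_ge [CompactSpace M] (hM : IsMetricallyConvex M)
    {g : LipZero o} (hg : ‖g‖ = 1) {φ : StrongDual ℝ (LipZero o)} (hφ : φ ≠ 0) {ε : ℝ}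
    (hε : 0 < ε) (hε1 : ε < 1 / 2) :
    ∃ f : LipZero o, ‖f‖ ≤ 1 + ε ∧ 1 + ‖φ‖ * (1 - 2 * ε) * (1 - ε) ≤ ‖f + φ f • g‖ := by
  classical
  set a := ‖φ‖ with hadef
  have ha : 0 < a := norm_pos_iff.2 hφ
  obtain ⟨f₀, hf₀, hφf₀⟩ : ∃ f₀ : LipZero o, ‖f₀‖ ≤ 1 ∧ a * (1 - ε) < φ f₀ := by
    by_contra! hcon
    have : ‖φ‖ ≤ a * (1 - ε) := by
      refine ContinuousLinearMap.opNorm_le_of_unit_norm (mul_nonneg ha.le (by linarith))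
        fun x hx => ?_
      rw [Real.norm_eq_abs, abs_le']
      exact ⟨hcon x hx.le, by simpa using hcon (-x) (by rw [norm_neg]; exact hx.le)⟩
    nlinarith
  obtain ⟨N, hN⟩ := exists_nat_gt (6 / ε)
  have hN0 : (0 : ℝ) < N := lt_trans (by positivity) hN
  obtain ⟨s, hsS, hscard⟩ := (infinite_steepPoints hM (f := g) (c := 1 - ε) (by linarith)
    (by linarith)).exists_subset_card_eq N
  have hsne : s.Nonempty := Finset.card_pos.1 (by rw [hscard]; exact_mod_cast hN0)
  obtain ⟨R, hR, hsep⟩ : ∃ R > 0, ∀ p ∈ s, ∀ p' ∈ s, p ≠ p' → 2 * R ≤ dist p p' := by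
    have hev : ∀ᶠ R in 𝓝[>] (0 : ℝ), ∀ p ∈ s, ∀ p' ∈ s, p ≠ p' → 2 * R ≤ dist p p' := by
      rw [Filter.eventually_all_finset]
      intro p _
      rw [Filter.eventually_all_finset]
      intro p' _
      rcases eq_or_ne p p' with rfl | hne
      · simp
      · have : 0 < dist p p' / 2 := half_pos (dist_pos.2 hne)
        filter_upwards [nhdsWithin_le_nhds (Iio_mem_nhds this)] with R hR _
        rw [Set.mem_Iio] at hR
        linarith
    obtain ⟨R, hR1, hR2⟩ := (hev.and self_mem_nhdsWithin).exists
    exact ⟨R, hR2, hR1⟩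
  have hloc : ∀ p ∈ s, ∃ q, p ≠ q ∧ (1 - ε) * dist p q < g p - g q ∧
      ∃ F : M → ℝ, LipschitzWith (1 + ε).toNNReal F ∧ (∀ z, R ≤ dist z p → F z = f₀ z) ∧
        F p - F q = dist p q := fun p hp => by
    obtain ⟨q, hpq, hd, hlt⟩ := hsS hp (ε * R / 3) (by positivity)
    exact ⟨q, hpq, hlt, exists_steep_modification f₀ hf₀ hε (by linarith) hR hd⟩
  have hex : ∀ p ∈ s, ∃ f : LipZero o, ‖f‖ ≤ 1 + ε ∧
      (∀ x y, R ≤ dist x p → R ≤ dist y p → f x - f y = f₀ x - f₀ y) ∧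
      ∃ q, p ≠ q ∧ (1 - ε) * dist p q < g p - g q ∧ f p - f q = dist p q := fun p hp => by
    obtain ⟨q, hpq, hlt, F, hF, hFR, hFpq⟩ := hloc p hp
    refine ⟨LipZero.ofLipschitz o hF, ?_, fun x y hx hy => ?_, q, hpq, hlt, ?_⟩
    · exact (LipZero.norm_ofLipschitz_le hF).trans
        (Real.coe_toNNReal _ (by linarith)).le
    · rw [LipZero.ofLipschitz_apply, LipZero.ofLipschitz_apply, hFR x hx, hFR y hy,
        sub_sub_sub_cancel_right]
    · rw [LipZero.ofLipschitz_apply, LipZero.ofLipschitz_apply, sub_sub_sub_cancel_right, hFpq]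
  choose! F hFn hFR q hpq hgq hFq using hex
  have hsum : ‖∑ p ∈ s, (F p - f₀)‖ ≤ 2 * 3 := by
    refine norm_sum_le_of_disjoint_supports (by norm_num) hsep (fun p hp => ?_)
      fun p hp x y hx hy => ?_
    · have := norm_sub_le (F p) f₀
      linarith [hFn p hp]
    · have h1 := hFR p hp x y hx hy
      have h2 : ∀ z, (F p - f₀) z = F p z - f₀ z := fun z => rfl
      rw [h2, h2]
      linarith
  obtain ⟨p, hp, hφp⟩ : ∃ p ∈ s, -(a * ε) ≤ φ (F p - f₀) := by
    refine Finset.exists_le_of_sum_le hsne ?_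
    rw [← map_sum, Finset.sum_const, hscard, nsmul_eq_mul]
    have h1 := (abs_le.1 (φ.le_of_opNorm_le le_rfl (∑ p ∈ s, (F p - f₀)))).1
    have h2 : a * ‖∑ p ∈ s, (F p - f₀)‖ ≤ a * (2 * 3) := by gcongr
    have h3 : 6 < N * ε := by rwa [div_lt_iff₀ hε] at hN
    have h4 : a * 6 ≤ a * (N * ε) := by gcongr
    linarith
  refine ⟨F p, hFn p hp, ?_⟩
  have hφF : a * (1 - 2 * ε) ≤ φ (F p) := by
    rw [map_sub] at hφp
    linarith
  have hd : 0 < dist p (q p) := dist_pos.2 (hpq p hp)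
  have hm1 : molecule o p (q p) (F p) = 1 := by
    rw [molecule_apply, hFq p hp, div_self hd.ne']
  have hm2 : 1 - ε ≤ molecule o p (q p) g := by
    rw [molecule_apply, le_div_iff₀ hd]
    exact (hgq p hp).le
  calc 1 + a * (1 - 2 * ε) * (1 - ε) ≤ 1 + φ (F p) * molecule o p (q p) g := by
        have h1 : 0 ≤ a * (1 - 2 * ε) := mul_nonneg ha.le (by linarith)
        have h2 : 0 ≤ φ (F p) := h1.trans hφF
        gcongr
        linarith
    _ = molecule o p (q p) (F p + φ (F p) • g) := by
        rw [map_add, map_smul, hm1, smul_eq_mul]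
    _ ≤ ‖F p + φ (F p) • g‖ := (le_abs_self _).trans (abs_molecule_le _ _ _)

theorem exists_eq_smulRight_of_finrank_range_eq_one {X : Type*} [NormedAddCommGroup X]
    [NormedSpace ℝ X] {T : X →L[ℝ] X}
    (hT : Module.finrank ℝ (LinearMap.range (T : X →ₗ[ℝ] X)) = 1) :
    ∃ (φ : StrongDual ℝ X) (g : X), φ ≠ 0 ∧ ‖g‖ = 1 ∧ T = φ.smulRight g := by
  obtain ⟨⟨v, hv⟩, hv0, hspan⟩ := finrank_eq_one_iff'.1 hT
  have hv0' : v ≠ 0 := fun h => hv0 (Subtype.ext h)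
  have hvn : ‖v‖ ≠ 0 := norm_ne_zero_iff.2 hv0'
  obtain ⟨ψ, -, hψv⟩ := exists_dual_vector ℝ v hvn
  have hψv' : ψ v = ‖v‖ := hψv
  have hTx : ∀ x, T x = ψ (T x) • (‖v‖⁻¹ • v) := fun x => by
    obtain ⟨c, hc⟩ := hspan ⟨T x, x, rfl⟩
    have hc' : c • v = T x := congrArg Subtype.val hc
    rw [← hc', map_smul, hψv', smul_smul, smul_eq_mul, mul_assoc, mul_inv_cancel₀ hvn, mul_one]
  refine ⟨ψ.comp T, ‖v‖⁻¹ • v, fun h => ?_, norm_smul_inv_norm hv0', ContinuousLinearMap.ext hTx⟩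
  obtain ⟨x, hx⟩ := hv
  have h1 : ψ (T x) = 0 := congrArg (fun χ : StrongDual ℝ X => χ x) h
  have h2 : T x = v := hx
  rw [h2, hψv'] at h1
  exact hvn h1

theorem IsMetricallyConvex.hasDaugavetProperty [CompactSpace M] (hM : IsMetricallyConvex M)
    (o : M) : HasDaugavetProperty (LipZero o) := by
  intro T hT
  obtain ⟨φ, g, hφ, hg, rfl⟩ := exists_eq_smulRight_of_finrank_range_eq_one hT
  set T := φ.smulRight g with hTdef
  have hTn : ‖T‖ = ‖φ‖ := by
    rw [hTdef, ContinuousLinearMap.norm_smulRight_apply, hg, mul_one]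
  refine le_antisymm ?_ ?_
  · refine (norm_add_le _ _).trans ?_
    rw [add_comm]
    gcongr
    exact ContinuousLinearMap.norm_id_le
  · rw [hTn]
    have hev : ∀ᶠ ε in 𝓝[>] (0 : ℝ), 1 + ‖φ‖ * (1 - 2 * ε) * (1 - ε) ≤
        ‖T + ContinuousLinearMap.id ℝ (LipZero o)‖ * (1 + ε) := by
      filter_upwards [Ioo_mem_nhdsGT (show (0 : ℝ) < 1 / 2 by norm_num)] with ε hε
      obtain ⟨f, hf, hle⟩ := hM.exists_norm_add_smul_ge hg hφ hε.1 hε.2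
      refine hle.trans ?_
      have h1 : f + φ f • g = (T + ContinuousLinearMap.id ℝ (LipZero o)) f := by
        rw [add_apply, ContinuousLinearMap.id_apply, add_comm]; rfl
      rw [h1]
      refine (ContinuousLinearMap.le_opNorm _ f).trans ?_
      gcongr
    have hl : Tendsto (fun ε : ℝ => 1 + ‖φ‖ * (1 - 2 * ε) * (1 - ε)) (𝓝[>] 0)
        (𝓝 (1 + ‖φ‖ * (1 - 2 * 0) * (1 - 0))) :=
      ((by fun_prop : Continuous fun ε : ℝ => 1 + ‖φ‖ * (1 - 2 * ε) * (1 - ε)).tendsto 0).mono_left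
        nhdsWithin_le_nhds
    have hr : Tendsto (fun ε : ℝ => ‖T + ContinuousLinearMap.id ℝ (LipZero o)‖ * (1 + ε)) (𝓝[>] 0)
        (𝓝 (‖T + ContinuousLinearMap.id ℝ (LipZero o)‖ * (1 + 0))) :=
      ((by fun_prop : Continuous fun ε : ℝ =>
        ‖T + ContinuousLinearMap.id ℝ (LipZero o)‖ * (1 + ε)).tendsto 0).mono_left
        nhdsWithin_le_nhds
    have := le_of_tendsto_of_tendsto hl hr hev
    simpa using this

end Daugavet

/-! ### Milman's theorem on extreme points -/

section Milman

variable {E : Type*} [AddCommGroup E] [Module ℝ E] [TopologicalSpace E]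

theorem isCompact_convexJoin [ContinuousAdd E] [ContinuousSMul ℝ E] {A B : Set E}
    (hA : IsCompact A) (hB : IsCompact B) : IsCompact (convexJoin ℝ A B) := by
  have himg : convexJoin ℝ A B =
      (fun p : (E × E) × ℝ => (1 - p.2) • p.1.1 + p.2 • p.1.2) '' ((A ×ˢ B) ×ˢ Set.Icc 0 1) := by
    ext x
    simp only [mem_convexJoin, segment_eq_image, Set.mem_image, Set.mem_prod, Prod.exists]
    constructor
    · rintro ⟨a, ha, b, hb, t, ht, rfl⟩
      exact ⟨a, b, t, ⟨⟨ha, hb⟩, ht⟩, rfl⟩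
    · rintro ⟨a, b, t, ⟨⟨ha, hb⟩, ht⟩, rfl⟩
      exact ⟨a, ha, b, hb, t, ht, rfl⟩
  rw [himg]
  exact ((hA.prod hB).prod isCompact_Icc).image (by fun_prop)

/-- Milman's converse of the Krein–Milman theorem. If `e` is not in the closure of `V`, then each
point of the closure has a neighbourhood whose trace on `V` lies in a compact convex subset of the
hull that misses `e`. As `e` is extreme, this property is inherited by finite unions, hence `V`
itself lies in such a subset. -/
theorem mem_closure_of_mem_extremePoints [IsTopologicalAddGroup E] [ContinuousSMul ℝ E]
    [LocallyConvexSpace ℝ E] [T2Space E] {V K : Set E} (hK : IsCompact K) (hVK : V ⊆ K)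
    (hKV : K ⊆ closure (convexHull ℝ V)) (hKc : Convex ℝ K) {e : E}
    (he : e ∈ Set.extremePoints ℝ K) : e ∈ closure V := by
  by_contra hcl
  have heK : e ∈ K := he.1
  have hclK : closure V ⊆ K := closure_minimal hVK hK.isClosed
  have hcomp : IsCompact (closure V) := hK.of_isClosed_subset isClosed_closure hclK
  obtain ⟨A, -, hAcomp, hAconv, hVA, heA⟩ : ∃ A ⊆ K, IsCompact A ∧ Convex ℝ A ∧
      closure V ∩ V ⊆ A ∧ e ∉ A := by
    refine hcomp.induction_on
      (p := fun S => ∃ A ⊆ K, IsCompact A ∧ Convex ℝ A ∧ S ∩ V ⊆ A ∧ e ∉ A) ?_ ?_ ?_ ?_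
    · exact ⟨∅, Set.empty_subset _, isCompact_empty, convex_empty, by simp, by simp⟩
    · rintro S T hST ⟨A, hAK, hA, hAc, hTA, heA⟩
      exact ⟨A, hAK, hA, hAc, (Set.inter_subset_inter_left V hST).trans hTA, heA⟩
    · rintro S T ⟨A, hAK, hA, hAc, hSA, heA⟩ ⟨B, hBK, hB, hBc, hTB, heB⟩
      rcases A.eq_empty_or_nonempty with rfl | hAne
      · refine ⟨B, hBK, hB, hBc, ?_, heB⟩
        rintro v ⟨hv | hv, hvV⟩
        · exact (hSA ⟨hv, hvV⟩).elim
        · exact hTB ⟨hv, hvV⟩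
      rcases B.eq_empty_or_nonempty with rfl | hBne
      · refine ⟨A, hAK, hA, hAc, ?_, heA⟩
        rintro v ⟨hv | hv, hvV⟩
        · exact hSA ⟨hv, hvV⟩
        · exact (hTB ⟨hv, hvV⟩).elim
      refine ⟨convexJoin ℝ A B, convexJoin_subset hAK hBK hKc, isCompact_convexJoin hA hB,
        hAc.convexJoin hBc, ?_, fun h => ?_⟩
      · rintro v ⟨hv | hv, hvV⟩
        · exact subset_convexJoin_left hBne (hSA ⟨hv, hvV⟩)
        · exact subset_convexJoin_right hAne (hTB ⟨hv, hvV⟩)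
      · obtain ⟨a, ha, b, hb, hab⟩ := mem_convexJoin.1 h
        rcases (mem_extremePoints_iff_forall_segment.1 he).2 a (hAK ha) b (hBK hb) hab with h | h
        · exact heA (h ▸ ha)
        · exact heB (h ▸ hb)
    · intro v hv
      have hve : v ≠ e := fun h => hcl (h ▸ hv)
      obtain ⟨f, hf⟩ := geometric_hahn_banach_point_point hve
      obtain ⟨m, hm1, hm2⟩ := exists_between hf
      refine ⟨{w | f w ≤ m}, mem_nhdsWithin_of_mem_nhds
        (f.continuous.continuousAt.eventually_le_const hm1), K ∩ {w | f w ≤ m},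
        Set.inter_subset_left,
        hK.inter_right (isClosed_le f.continuous continuous_const),
        hKc.inter (convex_halfSpace_le f.toLinearMap.isLinear m), fun w hw => ⟨hVK hw.2, hw.1⟩,
        fun h => ?_⟩
      exact absurd h.2 (not_le.2 hm2)
  exact heA (closure_minimal (convexHull_min (fun v hv => hVA ⟨subset_closure hv, hv⟩) hAconv)
    hAcomp.isClosed (hKV heK))

end Milman

/-! ### Preserved extreme points of the ball of `F(M)` -/

section PreservedExtreme

variable {M : Type*} [MetricSpace M] {o : M}

/-- The dual ball of `Lip₀(M)` is the weak* closed convex hull of the molecules, so that an extreme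
point is a weak* limit of molecules. -/
theorem exists_ultrafilter_of_mem_extremePoints {μ : StrongDual ℝ (LipZero o)}
    (hμ : μ ∈ Set.extremePoints ℝ (Metric.closedBall (0 : StrongDual ℝ (LipZero o)) 1)) :
    ∃ 𝓤 : Ultrafilter (M × M),
      ∀ f : LipZero o, Tendsto (fun p : M × M => molecule o p.1 p.2 f) 𝓤 (𝓝 (μ f)) := by
  have : LocallyConvexSpace ℝ (WeakDual ℝ (LipZero o)) :=
    inferInstanceAs (LocallyConvexSpace ℝ (WeakBilin (topDualPairing ℝ (LipZero o))))
  let T : M × M → WeakDual ℝ (LipZero o) := fun p => StrongDual.toWeakDual (molecule o p.1 p.2)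
  let K : Set (WeakDual ℝ (LipZero o)) :=
    WeakDual.toStrongDual ⁻¹' Metric.closedBall (0 : StrongDual ℝ (LipZero o)) 1
  have hKcomp : IsCompact K := WeakDual.isCompact_closedBall 0 1
  have hKconv : Convex ℝ K :=
    (convex_closedBall (0 : StrongDual ℝ (LipZero o)) 1).linear_preimage
      (WeakDual.toStrongDual : WeakDual ℝ (LipZero o) ≃ₗ[ℝ] _).toLinearMap
  have hVK : T '' Set.univ ⊆ K := by
    rintro _ ⟨p, -, rfl⟩
    exact mem_closedBall_zero_iff.2 (norm_molecule_le _ _)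
  have hKV : K ⊆ closure (convexHull ℝ (T '' Set.univ)) := by
    intro a ha
    by_contra hcl
    obtain ⟨F, u, hu, hau⟩ := geometric_hahn_banach_closed_point
      (convex_convexHull ℝ (T '' Set.univ)).closure isClosed_closure hcl
    obtain ⟨g, hg⟩ := LinearMap.dualEmbedding_surjective (topDualPairing ℝ (LipZero o)) F
    have hFg : ∀ b : WeakDual ℝ (LipZero o), F b = b g := fun b => by rw [← hg]; rfl
    have hmol : ∀ x y, molecule o x y g < u := fun x y => by
      have := hu (T (x, y)) (subset_closure (subset_convexHull ℝ _ ⟨(x, y), trivial, rfl⟩))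
      rwa [hFg] at this
    have hu0 : 0 ≤ u := by
      have h1 := hmol o o
      rw [molecule_apply, sub_self, zero_div] at h1
      exact h1.le
    have hgu : ‖g‖ ≤ u := by
      by_contra! hlt
      obtain ⟨x, y, -, h⟩ := exists_lt_molecule hu0 hlt
      exact lt_asymm h (hmol x y)
    rw [hFg] at hau
    have h1 := (WeakDual.toStrongDual a).le_of_opNorm_le (mem_closedBall_zero_iff.1 ha) g
    have h2 : a g ≤ 1 * ‖g‖ := (le_abs_self _).trans h1
    linarith
  have hext : StrongDual.toWeakDual μ ∈ Set.extremePoints ℝ K := by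
    refine ⟨hμ.1, fun a ha b hb hab => ?_⟩
    exact hμ.2 ha hb hab
  obtain ⟨𝓥, hV, hlim⟩ := mem_closure_iff_ultrafilter.1
    (mem_closure_of_mem_extremePoints hKcomp hVK hKV hKconv hext)
  refine ⟨Ultrafilter.ofComapInfPrincipal hV, fun f => ?_⟩
  have h1 : Tendsto T (Ultrafilter.ofComapInfPrincipal hV) (𝓝 (StrongDual.toWeakDual μ)) := by
    rw [Tendsto, ← Ultrafilter.coe_map, Ultrafilter.ofComapInfPrincipal_eq_of_map]
    exact hlim
  exact ((WeakDual.eval_continuous f).tendsto _).comp h1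

/-- On bounded subsets of `Lip₀(M)` the elements of `F(M)` are continuous for uniform convergence;
the lemma is the case of approximation by functions in the kernel. -/
theorem apply_eq_zero_of_mem_lipFree {μ : StrongDual ℝ (LipZero o)} (hμ : μ ∈ LipFree o)
    {f : LipZero o} {C : ℝ}
    (h : ∀ r > 0, ∃ g : LipZero o, ‖g‖ ≤ C ∧ (∀ z, |f z - g z| ≤ r) ∧ μ g = 0) : μ f = 0 := by
  have hspan : ∀ ν ∈ Submodule.span ℝ (Set.range (lipEval o)), ∃ B ≥ 0, ∀ (g : LipZero o) (r : ℝ),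
      (∀ z, |g z| ≤ r) → |ν g| ≤ B * r := by
    intro ν hν
    induction hν using Submodule.span_induction with
    | mem ν hν =>
      obtain ⟨x, rfl⟩ := hν
      exact ⟨1, zero_le_one, fun g r hr => by rw [one_mul]; exact hr x⟩
    | zero => exact ⟨0, le_rfl, fun g r _ => by simp⟩
    | add a b ha hb iha ihb =>
      obtain ⟨A, hA, hA'⟩ := iha
      obtain ⟨B, hB, hB'⟩ := ihb
      refine ⟨A + B, add_nonneg hA hB, fun g r hr => ?_⟩
      rw [add_apply, add_mul]
      exact (abs_add_le _ _).trans (add_le_add (hA' g r hr) (hB' g r hr))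
    | smul c a ha iha =>
      obtain ⟨A, hA, hA'⟩ := iha
      refine ⟨|c| * A, by positivity, fun g r hr => ?_⟩
      rw [smul_apply, smul_eq_mul, abs_mul, mul_assoc]
      gcongr
      exact hA' g r hr
  have hC : 0 ≤ C := by
    obtain ⟨g, hg, -⟩ := h 1 one_pos
    exact (norm_nonneg g).trans hg
  refine abs_nonpos_iff.1 (le_of_forall_pos_le_add fun ε hε => ?_)
  set L := ‖f‖ + C + 1 with hL
  have hLpos : 0 < L := by positivity
  obtain ⟨ν, hν, hd⟩ := Metric.mem_closure_iff.1 hμ (ε / (2 * L)) (by positivity)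
  obtain ⟨B, hB, hBν⟩ := hspan ν hν
  obtain ⟨g, hg, hfg, hμg⟩ := h (ε / (2 * (B + 1))) (by positivity)
  have h1 : |(μ - ν) (f - g)| ≤ ε / (2 * L) * L := by
    rw [dist_eq_norm] at hd
    refine ((μ - ν).le_of_opNorm_le hd.le (f - g)).trans ?_
    gcongr
    exact (norm_sub_le f g).trans (by linarith)
  have h2 : |ν (f - g)| ≤ (B + 1) * (ε / (2 * (B + 1))) :=
    (hBν (f - g) _ hfg).trans (by gcongr; linarith)
  have h3 : μ f = (μ - ν) (f - g) + ν (f - g) := by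
    rw [sub_apply, sub_add_cancel, map_sub, hμg, sub_zero]
  have h4 : ε / (2 * L) * L = ε / 2 := by field_simp
  have h5 : (B + 1) * (ε / (2 * (B + 1))) = ε / 2 := by field_simp
  rw [h3, zero_add]
  refine (abs_add_le _ _).trans ?_
  linarith

/-- The soft threshold function `s ↦ sign(s) max(|s| - r, 0)`. -/
def softThreshold (r s : ℝ) : ℝ := max (s - r) 0 + min (s + r) 0

theorem lipschitzWith_softThreshold {r : ℝ} (hr : 0 ≤ r) : LipschitzWith 1 (softThreshold r) := by
  refine LipschitzWith.of_le_add fun s t => ?_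
  have := abs_le.1 (Real.dist_eq s t).ge
  unfold softThreshold
  rcases max_cases (s - r) 0 with h | h <;> rcases max_cases (t - r) 0 with h' | h' <;>
    rcases min_cases (s + r) 0 with h'' | h'' <;> rcases min_cases (t + r) 0 with h''' | h''' <;>
    linarith

theorem abs_sub_softThreshold_le {r : ℝ} (hr : 0 ≤ r) (s : ℝ) : |s - softThreshold r s| ≤ r := by
  unfold softThreshold
  rw [abs_le]
  rcases max_cases (s - r) 0 with h | h <;> rcases min_cases (s + r) 0 with h' | h' <;>
    constructor <;> linarith

theorem softThreshold_eq_zero {r s : ℝ} (h : |s| ≤ r) : softThreshold r s = 0 := by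
  rw [abs_le] at h
  rw [softThreshold, max_eq_right (by linarith), min_eq_right (by linarith), add_zero]

/-- An element of `F(M)` that vanishes on the functions that are constant near `x` is zero. -/
theorem eq_zero_of_forall_eventually_const {μ : StrongDual ℝ (LipZero o)} (hμ : μ ∈ LipFree o)
    (x : M) (h : ∀ g : LipZero o, (∀ᶠ z in 𝓝 x, g z = g x) → μ g = 0) : μ = 0 := by
  ext f
  refine apply_eq_zero_of_mem_lipFree hμ (C := ‖f‖) fun r hr => ?_
  have hshift : LipschitzWith ‖f‖₊ fun z => f z - f x :=
    LipschitzWith.of_dist_le_mul fun u v => by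
      simpa using f.lipschitzWith.dist_le_mul u v
  have hlip : LipschitzWith (1 * ‖f‖₊) fun z => softThreshold (r / 2) (f z - f x) :=
    (lipschitzWith_softThreshold (half_pos hr).le).comp hshift
  refine ⟨LipZero.ofLipschitz o hlip, ?_, fun z => ?_, h _ ?_⟩
  · simpa using LipZero.norm_ofLipschitz_le (o := o) hlip
  · rw [LipZero.ofLipschitz_apply]
    have h1 := abs_le.1 (abs_sub_softThreshold_le (half_pos hr).le (f z - f x))
    have h2 := abs_le.1 (abs_sub_softThreshold_le (half_pos hr).le (f o - f x))
    rw [LipZero.map_base] at h2 ⊢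
    rw [abs_le]
    constructor <;> linarith
  · have hcont : Tendsto (fun z => f z) (𝓝 x) (𝓝 (f x)) := f.lipschitzWith.continuous.tendsto x
    filter_upwards [Metric.tendsto_nhds.1 hcont (r / 2) (half_pos hr)] with z hz
    rw [Real.dist_eq] at hz
    have hx : |f x - f x| ≤ r / 2 := by simpa using (half_pos hr).le
    rw [LipZero.ofLipschitz_apply, LipZero.ofLipschitz_apply, softThreshold_eq_zero hz.le,
      softThreshold_eq_zero hx]

theorem exists_molecule_eq_of_isPreservedExtremePoint [CompactSpace M] [Nontrivial M]
    {μ : LipFree o} (hμ : IsPreservedExtremePoint μ) :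
    ∃ x y, x ≠ y ∧ μ.1 = molecule o x y := by
  have hext := (isPreservedExtremePoint_iff μ).1 hμ
  obtain ⟨𝓤, hlim⟩ := exists_ultrafilter_of_mem_extremePoints hext
  obtain ⟨⟨x, y⟩, -, hxy⟩ := isCompact_univ.ultrafilter_le_nhds 𝓤 (by simp)
  rcases eq_or_ne x y with rfl | hne'
  · exfalso
    have hzero : μ.1 = 0 := eq_zero_of_forall_eventually_const μ.2 x fun g hg => by
      have h1 : ∀ᶠ p in (𝓤 : Filter (M × M)), molecule o p.1 p.2 g = 0 := by
        have h2 : ∀ᶠ p : M × M in 𝓝 (x, x), g p.1 = g x ∧ g p.2 = g x :=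
          (continuous_fst.tendsto (x, x)).eventually hg |>.and
            ((continuous_snd.tendsto (x, x)).eventually hg)
        filter_upwards [hxy h2] with p hp
        rw [molecule_apply, hp.1, hp.2, sub_self, zero_div]
      exact tendsto_nhds_unique (hlim g) (tendsto_const_nhds.congr' (h1.mono fun p hp => hp.symm))
    obtain ⟨a, b, hab⟩ := exists_pair_ne M
    rw [hzero] at hext
    have hball : molecule o a b ∈ Metric.closedBall (0 : StrongDual ℝ (LipZero o)) 1 :=
      mem_closedBall_zero_iff.2 (norm_molecule_le a b)
    have hball' : -molecule o a b ∈ Metric.closedBall (0 : StrongDual ℝ (LipZero o)) 1 := by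
      rw [← molecule_swap]
      exact mem_closedBall_zero_iff.2 (norm_molecule_le b a)
    have h0 := hext.2 hball hball'
      ⟨1 / 2, 1 / 2, by norm_num, by norm_num, by norm_num, by rw [smul_neg, add_neg_cancel]⟩
    have h1 : molecule o a b (LipZero.ofLipschitz o (LipschitzWith.dist_left b)) = 1 := by
      rw [molecule_apply, LipZero.ofLipschitz_apply, LipZero.ofLipschitz_apply, dist_self,
        sub_sub_sub_cancel_right, sub_zero, div_self (dist_pos.2 hab).ne']
    rw [h0] at h1
    simp at h1
  · refine ⟨x, y, hne', ContinuousLinearMap.ext fun f => tendsto_nhds_unique (hlim f) ?_⟩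
    have h1 : Tendsto (fun p : M × M => molecule o p.1 p.2) 𝓤 (𝓝 (molecule o x y)) :=
      (continuousAt_molecule hne').tendsto.mono_left hxy
    exact ((ContinuousLinearMap.apply ℝ ℝ f).continuous.tendsto _).comp h1

/-- A point `z` of the segment `[x, y]` splits the molecule of `x` and `y` into a convex combination
of the molecules of `x, z` and `z, y`. -/
theorem molecule_not_mem_extremePoints {x y z : M} (hz : z ∈ metricSegment x y) (hzx : z ≠ x)
    (hzy : z ≠ y) : molecule o x y ∉
      Set.extremePoints ℝ (Metric.closedBall (0 : StrongDual ℝ (LipZero o)) 1) := by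
  intro hext
  have hz' : dist x z + dist z y = dist x y := hz
  have h1 : 0 < dist x z := dist_pos.2 hzx.symm
  have h2 : 0 < dist z y := dist_pos.2 hzy
  have hD : 0 < dist x y := by linarith
  have heq : molecule o x z = molecule o x y := by
    refine hext.2 (mem_closedBall_zero_iff.2 (norm_molecule_le x z))
      (mem_closedBall_zero_iff.2 (norm_molecule_le z y))
      ⟨dist x z / dist x y, dist z y / dist x y, by positivity, by positivity, ?_, ?_⟩
    · rw [← add_div, hz', div_self hD.ne']
    · ext f
      rw [add_apply, smul_apply, smul_apply, smul_eq_mul, smul_eq_mul, molecule_apply,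
        molecule_apply, molecule_apply]
      field_simp
      ring
  -- a function that is constant on `{x, z}` and smaller at `y`
  set r := min (dist x y) (dist z y) with hr
  have hrpos : 0 < r := lt_min hD h2
  have hlip : LipschitzWith 1 fun w => min (dist w y) r := (LipschitzWith.dist_left y).min_const r
  have h3 : molecule o x z (LipZero.ofLipschitz o hlip) =
      molecule o x y (LipZero.ofLipschitz o hlip) := by rw [heq]
  rw [molecule_apply, molecule_apply, LipZero.ofLipschitz_apply, LipZero.ofLipschitz_apply,
    LipZero.ofLipschitz_apply, min_eq_right (min_le_left _ _), min_eq_right (min_le_right _ _),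
    dist_self, min_eq_left hrpos.le, sub_self, zero_div, sub_sub_sub_cancel_right, sub_zero] at h3
  have : 0 < r / dist x y := by positivity
  linarith

theorem IsMetricallyConvex.not_isPreservedExtremePoint [CompactSpace M] [Nontrivial M]
    (hM : IsMetricallyConvex M) (μ : LipFree o) : ¬ IsPreservedExtremePoint μ := by
  intro hμ
  obtain ⟨x, y, hxy, hμxy⟩ := exists_molecule_eq_of_isPreservedExtremePoint hμ
  obtain ⟨z, hz, hzne⟩ := hM x y hxy
  simp only [Set.mem_insert_iff, Set.mem_singleton_iff, not_or] at hzne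
  refine molecule_not_mem_extremePoints hz hzne.1 hzne.2 (o := o) ?_
  rw [← hμxy]
  exact (isPreservedExtremePoint_iff μ).1 hμ

end PreservedExtreme

/-! ### The equivalences -/

theorem corollary4p9 {M : Type*} [MetricSpace M] [CompactSpace M] [Nontrivial M] (o : M) :
    List.TFAE [
      IsGeodesicSpace M,
      ∀ x y : M, x ≠ y → (metricSegment x y \ {x, y}).Nonempty,
      HasDaugavetProperty (LipZero o),
      ¬ ∃ μ : LipFree o, IsPreservedExtremePoint μ,
      ¬ ∃ μ : LipFree o, IsStronglyExposedPoint μ,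
      ¬ ∃ f : LipZero o, GateauxDifferentiableAt (fun g : LipZero o => ‖g‖) f,
      ¬ ∃ f : LipZero o, DifferentiableAt ℝ (fun g : LipZero o => ‖g‖) f] := by
  have : Nontrivial (LipZero o) := lipZero_nontrivial
  tfae_have 1 → 2 := fun h => h.isMetricallyConvex
  tfae_have 2 → 1 := fun h => IsMetricallyConvex.isGeodesicSpace h
  tfae_have 2 → 3 := fun h => IsMetricallyConvex.hasDaugavetProperty h o
  tfae_have 2 → 4 := fun h ⟨μ, hμ⟩ => IsMetricallyConvex.not_isPreservedExtremePoint h μ hμ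
  tfae_have 2 → 6 := fun h ⟨f, hf⟩ => IsMetricallyConvex.not_gateauxDifferentiableAt_norm h f hf
  tfae_have 3 → 7 := fun h ⟨f, hf⟩ => h.not_differentiableAt_norm f hf
  tfae_have 4 → 7 := fun h ⟨_, hf⟩ => h (exists_isPreservedExtremePoint_of_differentiableAt hf)
  tfae_have 6 → 7 := fun h ⟨f, φ, hφ⟩ => h ⟨f, φ, fun v => hφ.hasLineDerivAt v⟩
  tfae_have 5 → 7 := fun h ⟨_, hf⟩ => h (exists_isStronglyExposedPoint_of_differentiableAt hf)
  tfae_have 7 → 5 := fun h ⟨_, hμ⟩ => h (exists_differentiableAt_of_isStronglyExposedPoint hμ)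
  tfae_have 7 → 2 := fun h => by
    by_contra hM
    obtain ⟨x, y, hxy, ε, hε, hε1, hgap⟩ := exists_gap_of_not_isMetricallyConvex hM
    exact h (exists_differentiableAt_norm_of_gap o hxy hε hε1 hgap)
  tfae_finish
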